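/- Let $G$ be a compact Lie group, and let $\Lambda$ be a set of irreducible unitary representations of $G$ containing exactly one from each equivalence class, among them the trivial representation on $\mathbb C$. A (finite, directed) graph $\phi$ consists of finite sets $E_\phi$ of edges and $V_\phi$ of vertices and maps $s,t\colon E_\phi\to V_\phi$. Let $P\to V_\phi$ be a principal $G$-bundle ($V_\phi$ discrete). A connection on $\phi$ assigns to each edge $e$ a smooth map $A_e\colon P_{s(e)}\to P_{t(e)}$ with $A_e(xg)=A_e(x)g$; let $\mathcal A_\phi$ be the space of connections. A trivialization of $P$ identifies $\mathcal A_\phi$ with $G^{E_\phi}$, and the product of normalized Haar measures then gives a probability measure $\mu_\phi$ on $\mathcal A_\phi$, independent of the trivialization. The group $\mathcal G_\phi=\prod_{v\in V_\phi}\mathrm{Aut}(P_v)$ acts on $\mathcal A_\phi$ by $(gA)_e=g_{t(e)}A_e g_{s(e)}^{-1}$, and $L^2(\mathcal A_\phi/\mathcal G_\phi)$ is formed with the push-forward of $\mu_\phi$ to $\mathcal A_\phi/\mathcal G_\phi$; it is identified with the $\mathcal G_\phi$-invariant subspace of $L^2(\mathcal A_\phi)$. For $\rho\in\Lambda^{E_\phi}$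 and $v\in V_\phi$, let $\mathrm{Inv}(v,\rho)$ be the space of $G$-invariant vectors in $\bigotimes_{s(e)=v}\rho_e\otimes\bigotimes_{t(e)=v}\rho_e^*$. Given $\iota_v\in\mathrm{Inv}(v,\rho)$ for each $v$, the spin network state $\Psi_{\rho,\iota}\in L^2(\mathcal A_\phi/\mathcal G_\phi)$ is the image of $\bigotimes_{v}\iota_v$ under $$\bigotimes_{v\in V_\phi}\Big(\bigotimes_{s(e)=v}\rho_e\otimes\bigotimes_{t(e)=v}\rho_e^*\Big)\cong\bigotimes_{e\in E_\phi}\rho_e\otimes\rho_e^*\hookrightarrow L^2(G^{E_\phi})\cong L^2(\mathcal A_\phi),$$ where $\xi\otimes\eta\in\rho_e\otimes\rho_e^*$ is sent to the function $x\mapsto\sqrt{\dim\rho_e}\,\eta(\rho_e(x)\xi)$ on $G$; this does not depend on the trivialization. A path in $\phi$ from $v_1$ to $v_{n+1}$ is a sequence of vertices $v_1,\dots,v_{n+1}$ with edges $f_1,\dots,f_n$ and exponents $\pm1$ such that $f_i$ goes from $v_i$ to $v_{i+1}$ (exponent $+1$) or from $v_{i+1}$ to $v_i$ (exponent $-1$).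 It is simple if $n\ge1$, the edges $f_1,\dots,f_n$ are distinct, and the vertices $v_1,\dots,v_{n+1}$ are distinct except that $v_1=v_{n+1}$ is allowed. An inclusion $i\colon\psi\hookrightarrow\phi$ of graphs is a one-to-one map $i\colon V_\psi\to V_\phi$ together with, for each $e\in E_\psi$, a simple path $i(e)$ in $\phi$ from $i(s(e))$ to $i(t(e))$, such that each edge of $\phi$ appears in at most one of the paths $i(e)$. Let $\psi,\phi$ be graphs with $V_\psi\neq\emptyset$, let $P_\phi\to V_\phi$ be a principal $G$-bundle, let $i\colon\psi\hookrightarrow\phi$ be an inclusion, and let $P_\psi=i^*P_\phi$. The map $i^*\colon\mathcal A_\phi\to\mathcal A_\psi$ with $i^*(A)_e=A_{f_n}^{\pm1}\cdots A_{f_1}^{\pm1}$ for $i(e)=f_1^{\pm1}\cdots f_n^{\pm1}$ induces, by composition, an isometry $i\colon L^2(\mathcal A_\psi/\mathcal G_\psi)\to L^2(\mathcal A_\phi/\mathcal G_\phi)$. **Lemma.** If $\Psi\in L^2(\mathcal A_\psi/\mathcal G_\psi)$ is such that $i(\Psi)$ is a spin network state in $L^2(\mathcal A_\phi/\mathcal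 G_\phi)$, then $\Psi$ is a spin network state in $L^2(\mathcal A_\psi/\mathcal G_\psi)$. -/

import Mathlib

open MeasureTheory Module
open scoped Manifold ContDiff TensorProduct

noncomputable section

namespace SpinNetwork

/-! ### Graphs, paths and inclusions -/

/-- A directed graph with vertex type `V` and edge type `E` (loops and multiple edges are allowed).
Finiteness is imposed through `Fintype V` and `Fintype E`. -/
structure DirGraph (V E : Type*) where
  source : E → V
  target : E → V

/-- Paths `f₁^{±1} ⋯ fₙ^{±1}` in a graph: every edge may be traversed forwards (exponent `+1`) or
backwards (exponent `-1`). The first edge traversed is the outermost constructor. -/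
inductive GPath {V E : Type*} (Γ : DirGraph V E) : V → V → Type _
  | nil (a : V) : GPath Γ a a
  | fwd (f : E) {b : V} (p : GPath Γ (Γ.target f) b) : GPath Γ (Γ.source f) b
  | bwd (f : E) {b : V} (p : GPath Γ (Γ.source f) b) : GPath Γ (Γ.target f) b

namespace GPath

variable {V E : Type*} {Γ : DirGraph V E}

/-- The list of the edges that appear in a path, in the order in which they are traversed. -/
def edges : ∀ {a b : V}, GPath Γ a b → List E
  | _, _, nil _ => []
  | _, _, fwd f p => f :: p.edges
  | _, _, bwd f p => f :: p.edges

/-- The list of the vertices `v₁, …, vₙ₊₁` that a path with `n` edges visits. -/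
def vertices : ∀ {a b : V}, GPath Γ a b → List V
  | _, _, nil a => [a]
  | _, _, fwd f p => Γ.source f :: p.vertices
  | _, _, bwd f p => Γ.target f :: p.vertices

/-- A path is simple if it has at least one edge, does not traverse an edge twice, and visits
pairwise distinct vertices, except that the first one may coincide with the last one. -/
def IsSimple {a b : V} (p : GPath Γ a b) : Prop :=
  p.edges ≠ [] ∧ p.edges.Nodup ∧ p.vertices.dropLast.Nodup ∧ p.vertices.tail.Nodup

end GPath

/-- An inclusion `ψ ↪ φ` of graphs. -/
structure Inclusion {Vψ Eψ Vφ Eφ : Type*} (ψ : DirGraph Vψ Eψ) (φ : DirGraph Vφ Eφ) where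
  vertex : Vψ → Vφ
  vertex_injective : Function.Injective vertex
  path : ∀ e : Eψ, GPath φ (vertex (ψ.source e)) (vertex (ψ.target e))
  path_simple : ∀ e, (path e).IsSimple
  path_disjoint : ∀ (f : Eφ) (e e' : Eψ), f ∈ (path e).edges → f ∈ (path e').edges → e = e'

/-! ### Principal bundles over the vertices -/

/-- A smooth principal `G`-bundle over the discrete space `V`: a family of smooth manifolds with a
right action of `G` (an action of the opposite group `Gᵐᵒᵖ`), each of which admits a local
trivialization, that is, a diffeomorphism with `G` that is compatible with the right actions. No
trivialization is part of the data. -/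
structure PrincipalBundle (𝔼 : Type*) [NormedAddCommGroup 𝔼] [NormedSpace ℝ 𝔼]
    (G : Type*) [TopologicalSpace G] [ChartedSpace 𝔼 G] [Group G] (V : Type*) where
  fibre : V → Type*
  [topology : ∀ v, TopologicalSpace (fibre v)]
  [charts : ∀ v, ChartedSpace 𝔼 (fibre v)]
  [manifold : ∀ v, IsManifold 𝓘(ℝ, 𝔼) ∞ (fibre v)]
  [action : ∀ v, MulAction Gᵐᵒᵖ (fibre v)]
  trivializable : ∀ v, ∃ τ : Diffeomorph 𝓘(ℝ, 𝔼) 𝓘(ℝ, 𝔼) G (fibre v) ∞,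
    ∀ x g : G, τ (x * g) = MulOpposite.op g • τ x

attribute [instance] PrincipalBundle.topology PrincipalBundle.charts PrincipalBundle.manifold
  PrincipalBundle.action

section Bundles

variable {𝔼 : Type*} [NormedAddCommGroup 𝔼] [NormedSpace ℝ 𝔼]
  {G : Type*} [TopologicalSpace G] [ChartedSpace 𝔼 G] [Group G]
  {V V' E : Type*}

/-- The pullback of a principal bundle along a map of (discrete) base spaces. -/
def PrincipalBundle.pullback (P : PrincipalBundle 𝔼 G V) (i : V' → V) :
    PrincipalBundle 𝔼 G V' where
  fibre v := P.fibre (i v)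
  trivializable v := P.trivializable (i v)

/-- Some trivialization of the fibre over `v`. The objects defined below by means of it do not
depend on its choice. -/
def PrincipalBundle.triv (P : PrincipalBundle 𝔼 G V) (v : V) :
    Diffeomorph 𝓘(ℝ, 𝔼) 𝓘(ℝ, 𝔼) G (P.fibre v) ∞ :=
  (P.trivializable v).choose

theorem PrincipalBundle.triv_mul (P : PrincipalBundle 𝔼 G V) (v : V) (x g : G) :
    P.triv v (x * g) = MulOpposite.op g • P.triv v x :=
  (P.trivializable v).choose_spec x g

theorem PrincipalBundle.triv_symm_smul (P : PrincipalBundle 𝔼 G V) (v : V) (p : P.fibre v)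
    (g : G) : (P.triv v).symm (MulOpposite.op g • p) = (P.triv v).symm p * g := by
  apply (P.triv v).injective
  change P.triv v _ = P.triv v _
  rw [P.triv_mul]
  simp

/-- The smooth maps `F : P_a → P_b` with `F (x g) = F x g`. -/
@[ext]
structure Transport (P : PrincipalBundle 𝔼 G V) (a b : V) where
  toFun : P.fibre a → P.fibre b
  smooth : ContMDiff 𝓘(ℝ, 𝔼) 𝓘(ℝ, 𝔼) ∞ toFun
  map_smul : ∀ (g : G) (x : P.fibre a),
    toFun (MulOpposite.op g • x) = MulOpposite.op g • toFun x

namespace Transport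

variable {P : PrincipalBundle 𝔼 G V} {a b c d : V}

/-- The element of `G` that corresponds to `F : P_a → P_b` in the trivializations of `P_a` and
`P_b`: there `F` is left multiplication by this element. -/
def coord (F : Transport P a b) : G := (P.triv b).symm (F.toFun (P.triv a 1))

theorem toFun_eq (F : Transport P a b) (x : P.fibre a) :
    F.toFun x = P.triv b (F.coord * (P.triv a).symm x) := by
  have h : x = MulOpposite.op ((P.triv a).symm x) • P.triv a 1 := by
    rw [← P.triv_mul]; simp
  conv_lhs => rw [h]
  rw [F.map_smul, P.triv_mul]
  simp [coord]

theorem coord_injective : Function.Injective (coord : Transport P a b → G) := by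
  intro F F' h
  ext x
  rw [toFun_eq, toFun_eq, h]

/-- The identity of `P_a`. -/
def id (P : PrincipalBundle 𝔼 G V) (a : V) : Transport P a a where
  toFun x := x
  smooth := contMDiff_id
  map_smul _ _ := rfl

/-- Composition of maps: `(F'.comp F) x = F' (F x)`. -/
def comp (F' : Transport P b c) (F : Transport P a b) : Transport P a c where
  toFun x := F'.toFun (F.toFun x)
  smooth := F'.smooth.comp F.smooth
  map_smul g x := by rw [F.map_smul, F'.map_smul]

theorem bijective (F : Transport P a b) : Function.Bijective F.toFun := by
  have h : F.toFun = P.triv b ∘ (F.coord * ·) ∘ (P.triv a).symm := by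
    funext x; exact F.toFun_eq x
  rw [h]
  exact (P.triv b).bijective.comp
    ((Group.mulLeft_bijective F.coord).comp (P.triv a).symm.bijective)

theorem coord_id : (id P a).coord = 1 := by simp [coord, id]

theorem coord_comp (F' : Transport P b c) (F : Transport P a b) :
    (F'.comp F).coord = F'.coord * F.coord := by
  simp only [coord, comp]
  rw [F'.toFun_eq]
  simp [coord]

variable [LieGroup 𝓘(ℝ, 𝔼) ∞ G]

/-- The map that is left multiplication by `g` in the trivializations of `P_a` and `P_b`. -/
def ofCoord (P : PrincipalBundle 𝔼 G V) (a b : V) (g : G) : Transport P a b where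
  toFun x := P.triv b (g * (P.triv a).symm x)
  smooth := (P.triv b).contMDiff.comp
    ((contMDiff_mul_left (I := 𝓘(ℝ, 𝔼)) (n := ∞) (a := g)).comp (P.triv a).symm.contMDiff)
  map_smul h x := by rw [P.triv_symm_smul, ← mul_assoc, P.triv_mul]

theorem coord_ofCoord (g : G) : (ofCoord P a b g).coord = g := by
  simp [coord, ofCoord]

/-- The identification of the space of smooth compatible maps `P_a → P_b` with `G`. -/
def coordEquiv (P : PrincipalBundle 𝔼 G V) (a b : V) : Transport P a b ≃ G where
  toFun := coord
  invFun := ofCoord P a b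
  left_inv _ := coord_injective (coord_ofCoord _)
  right_inv := coord_ofCoord

theorem coord_coordEquiv_symm (P : PrincipalBundle 𝔼 G V) (a b : V) (g : G) :
    ((coordEquiv P a b).symm g).coord = g := coord_ofCoord g

/-- The inverse map of a smooth compatible map. -/
def inv (F : Transport P a b) : Transport P b a where
  toFun := (Equiv.ofBijective F.toFun F.bijective).symm
  smooth := by
    have h : ⇑(Equiv.ofBijective F.toFun F.bijective).symm
        = (ofCoord P b a F.coord⁻¹).toFun := by
      funext y
      rw [Equiv.symm_apply_eq, Equiv.ofBijective_apply, F.toFun_eq]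
      simp [ofCoord]
    rw [h]
    exact (ofCoord P b a F.coord⁻¹).smooth
  map_smul g y := by
    rw [Equiv.symm_apply_eq, Equiv.ofBijective_apply, F.map_smul]
    congr 1
    exact ((Equiv.ofBijective F.toFun F.bijective).apply_symm_apply y).symm

theorem inv_comp (F : Transport P a b) : F.inv.comp F = id P a := by
  ext x
  exact (Equiv.ofBijective F.toFun F.bijective).symm_apply_apply x

theorem comp_inv (F : Transport P a b) : F.comp F.inv = id P b := by
  ext x
  exact (Equiv.ofBijective F.toFun F.bijective).apply_symm_apply x

theorem coord_inv (F : Transport P a b) : F.inv.coord = F.coord⁻¹ := by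
  rw [eq_inv_iff_mul_eq_one, ← coord_comp, inv_comp, coord_id]

/-- The automorphisms of a fibre form a group under composition. -/
instance : Group (Transport P a a) where
  mul := comp
  mul_assoc _ _ _ := rfl
  one := id P a
  one_mul _ := rfl
  mul_one _ := rfl
  inv := inv
  inv_mul_cancel F := F.inv_comp

theorem coord_one : (1 : Transport P a a).coord = 1 := coord_id

theorem coord_mul (F F' : Transport P a a) : (F * F').coord = F.coord * F'.coord :=
  coord_comp F F'

theorem coord_inv' (F : Transport P a a) : (F⁻¹).coord = F.coord⁻¹ := coord_inv F

end Transport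

/-! ### Connections and gauge transformations -/

/-- A connection on the graph `Γ`: a smooth compatible map `A_e : P_{s(e)} → P_{t(e)}` for every
edge `e`. -/
abbrev Connection (P : PrincipalBundle 𝔼 G V) (Γ : DirGraph V E) : Type _ :=
  ∀ e : E, Transport P (Γ.source e) (Γ.target e)

/-- A gauge transformation: an automorphism of every fibre of the bundle (the fibre of
`P ×_Ad G` over `v` is the group of automorphisms of `P_v`). -/
abbrev Gauge (P : PrincipalBundle 𝔼 G V) : Type _ := ∀ v : V, Transport P v v

/-- The holonomy `A_{fₙ}^{±1} ⋯ A_{f₁}^{±1}` of a connection along the path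
`f₁^{±1} ⋯ fₙ^{±1}`. -/
def holonomy [LieGroup 𝓘(ℝ, 𝔼) ∞ G] {P : PrincipalBundle 𝔼 G V} {Γ : DirGraph V E}
    (A : Connection P Γ) : ∀ {a b : V}, GPath Γ a b → Transport P a b
  | _, _, GPath.nil a => Transport.id P a
  | _, _, GPath.fwd f p => (holonomy A p).comp (A f)
  | _, _, GPath.bwd f p => (holonomy A p).comp (A f).inv

section Action

variable [LieGroup 𝓘(ℝ, 𝔼) ∞ G] {P : PrincipalBundle 𝔼 G V} {Γ : DirGraph V E}

/-- Gauge transformations act on connections by `(g A)_e = g_{t(e)} A_e g_{s(e)}⁻¹`. -/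
instance gaugeAction : MulAction (Gauge P) (Connection P Γ) where
  smul g A e := ((g (Γ.target e)).comp (A e)).comp (g (Γ.source e)).inv
  one_smul A := by
    funext e
    apply Transport.coord_injective
    change (((1 : Transport P _ _).comp (A e)).comp (1 : Transport P _ _)⁻¹).coord = _
    simp [Transport.coord_comp, Transport.coord_one]
  mul_smul g h A := by
    funext e
    apply Transport.coord_injective
    change (((g _ * h _).comp (A e)).comp (g _ * h _)⁻¹).coord
      = (((g _).comp (((h _).comp (A e)).comp (h _).inv)).comp (g _).inv).coord
    simp only [Transport.coord_comp, Transport.coord_mul, Transport.coord_inv,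
      Transport.coord_inv', mul_inv_rev, mul_assoc]

theorem smul_apply (g : Gauge P) (A : Connection P Γ) (e : E) :
    (g • A) e = ((g (Γ.target e)).comp (A e)).comp (g (Γ.source e)).inv := rfl

theorem holonomy_smul (g : Gauge P) (A : Connection P Γ) {a b : V} (p : GPath Γ a b) :
    holonomy (g • A) p = ((g b).comp (holonomy A p)).comp (g a).inv := by
  apply Transport.coord_injective
  induction p with
  | nil a => simp [holonomy, Transport.coord_comp, Transport.coord_inv, Transport.coord_id]
  | fwd f p ih =>
    simp only [holonomy, Transport.coord_comp, ih, smul_apply, Transport.coord_inv]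
    group
  | bwd f p ih =>
    simp only [holonomy, Transport.coord_comp, ih, smul_apply, Transport.coord_inv]
    group

/-- The space `𝒜/𝒢` of connections modulo gauge transformations. -/
def ModuliSpace (P : PrincipalBundle 𝔼 G V) (Γ : DirGraph V E) : Type _ :=
  MulAction.orbitRel.Quotient (Gauge P) (Connection P Γ)

/-- The quotient map `𝒜 → 𝒜/𝒢`. -/
def toModuli (A : Connection P Γ) : ModuliSpace P Γ :=
  (Quotient.mk (MulAction.orbitRel (Gauge P) (Connection P Γ)) A : Quotient _)

end Action

/-! ### The measures on `𝒜` and `𝒜/𝒢` and the Hilbert space `L²(𝒜/𝒢)` -/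

section Measures

variable [MeasurableSpace G] {P : PrincipalBundle 𝔼 G V} {Γ : DirGraph V E}

/-- The σ-algebra on the space of compatible maps `P_a → P_b` given by its identification
with `G`. The σ-algebra on the space of connections is the resulting product σ-algebra. -/
instance {a b : V} : MeasurableSpace (Transport P a b) :=
  MeasurableSpace.comap Transport.coord inferInstance

variable [LieGroup 𝓘(ℝ, 𝔼) ∞ G]

/-- `𝒜/𝒢` carries the quotient σ-algebra. -/
instance : MeasurableSpace (ModuliSpace P Γ) :=
  inferInstanceAs (MeasurableSpace (Quotient (MulAction.orbitRel (Gauge P) (Connection P Γ))))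

theorem measurable_toModuli : Measurable (toModuli : Connection P Γ → ModuliSpace P Γ) :=
  fun _ h => h

variable [BorelSpace G] [CompactSpace G]

/-- The Haar measure of total mass `1` on the compact group `G`. -/
def normalizedHaar (𝔼 : Type*) [NormedAddCommGroup 𝔼] [NormedSpace ℝ 𝔼]
    (G : Type*) [TopologicalSpace G] [ChartedSpace 𝔼 G] [Group G] [MeasurableSpace G]
    [LieGroup 𝓘(ℝ, 𝔼) ∞ G] [BorelSpace G] [CompactSpace G] : Measure G :=
  haveI : IsTopologicalGroup G := topologicalGroup_of_lieGroup 𝓘(ℝ, 𝔼) ∞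
  Measure.haarMeasure ⊤

/-- The measure `μ` on the space of connections: the product of copies of normalized Haar
measure. -/
def connectionMeasure [Fintype E] (P : PrincipalBundle 𝔼 G V) (Γ : DirGraph V E) :
    Measure (Connection P Γ) :=
  Measure.pi fun e =>
    (normalizedHaar 𝔼 G).map (Transport.coordEquiv P (Γ.source e) (Γ.target e)).symm

/-- The push-forward of `μ` to `𝒜/𝒢`. -/
def moduliMeasure [Fintype E] (P : PrincipalBundle 𝔼 G V) (Γ : DirGraph V E) :
    Measure (ModuliSpace P Γ) :=
  (connectionMeasure P Γ).map toModuli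

/-- The Hilbert space `L²(𝒜/𝒢)`. -/
abbrev L2 [Fintype E] (P : PrincipalBundle 𝔼 G V) (Γ : DirGraph V E) : Type _ :=
  Lp ℂ 2 (moduliMeasure P Γ)

end Measures

end Bundles

/-! ### The maps induced by an inclusion of graphs -/

section Haar

variable {𝔼 : Type*} [NormedAddCommGroup 𝔼] [NormedSpace ℝ 𝔼]
  {G : Type*} [TopologicalSpace G] [ChartedSpace 𝔼 G] [Group G] [MeasurableSpace G]
  [LieGroup 𝓘(ℝ, 𝔼) ∞ G] [BorelSpace G] [CompactSpace G]

instance : IsProbabilityMeasure (normalizedHaar 𝔼 G) := by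
  have : IsTopologicalGroup G := topologicalGroup_of_lieGroup 𝓘(ℝ, 𝔼) ∞
  exact ⟨Measure.haarMeasure_self⟩

theorem normalizedHaar_isHaarMeasure : (normalizedHaar 𝔼 G).IsHaarMeasure := by
  have : IsTopologicalGroup G := topologicalGroup_of_lieGroup 𝓘(ℝ, 𝔼) ∞
  unfold normalizedHaar
  infer_instance

theorem measurePreserving_mul_left (g : G) :
    MeasurePreserving (fun x : G => g * x) (normalizedHaar 𝔼 G) (normalizedHaar 𝔼 G) := by
  have : IsTopologicalGroup G := topologicalGroup_of_lieGroup 𝓘(ℝ, 𝔼) ∞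
  have := normalizedHaar_isHaarMeasure (𝔼 := 𝔼) (G := G)
  exact MeasureTheory.measurePreserving_mul_left _ g

theorem measurePreserving_mul_right (g : G) :
    MeasurePreserving (fun x : G => x * g) (normalizedHaar 𝔼 G) (normalizedHaar 𝔼 G) := by
  have : IsTopologicalGroup G := topologicalGroup_of_lieGroup 𝓘(ℝ, 𝔼) ∞
  have := normalizedHaar_isHaarMeasure (𝔼 := 𝔼) (G := G)
  have hm : Measurable (fun x : G => x * g) := (continuous_mul_const g).measurable
  refine ⟨hm, ?_⟩
  have : IsProbabilityMeasure ((normalizedHaar 𝔼 G).map (fun x : G => x * g)) :=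
    Measure.isProbabilityMeasure_map hm.aemeasurable
  have : ((normalizedHaar 𝔼 G).map (fun x : G => x * g)).IsHaarMeasure :=
    Measure.isHaarMeasure_map_mul_right _ g
  exact Measure.isHaarMeasure_eq_of_isProbabilityMeasure _ _

end Haar

section Words

variable {V E G : Type*} [Group G] {Γ : DirGraph V E}

/-- The holonomy of a family of group elements along a path. -/
def GPath.word (x : E → G) : ∀ {a b : V}, GPath Γ a b → G
  | _, _, GPath.nil _ => 1
  | _, _, GPath.fwd f p => p.word x * x f
  | _, _, GPath.bwd f p => p.word x * (x f)⁻¹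

theorem GPath.word_congr {x y : E → G} {a b : V} (p : GPath Γ a b)
    (h : ∀ f ∈ p.edges, x f = y f) : p.word x = p.word y := by
  induction p with
  | nil a => rfl
  | fwd f p ih =>
    simp only [GPath.edges, List.mem_cons] at h
    simp only [GPath.word, ih fun f' hf' => h f' (Or.inr hf'), h f (Or.inl rfl)]
  | bwd f p ih =>
    simp only [GPath.edges, List.mem_cons] at h
    simp only [GPath.word, ih fun f' hf' => h f' (Or.inr hf'), h f (Or.inl rfl)]

theorem GPath.measurable_word [MeasurableSpace G] [MeasurableMul₂ G] [MeasurableInv G]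
    {a b : V} (p : GPath Γ a b) : Measurable fun x : E → G => p.word x := by
  induction p with
  | nil a => exact measurable_const
  | fwd f p ih => exact ih.mul (measurable_pi_apply f)
  | bwd f p ih => exact ih.mul (measurable_pi_apply f).inv

end Words

section Holonomy

variable {𝔼 : Type*} [NormedAddCommGroup 𝔼] [NormedSpace ℝ 𝔼]
  {G : Type*} [TopologicalSpace G] [ChartedSpace 𝔼 G] [Group G]

theorem measurable_coord [MeasurableSpace G] {V : Type*} {P : PrincipalBundle 𝔼 G V} {a b : V} :
    Measurable (Transport.coord : Transport P a b → G) :=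
  comap_measurable _

theorem coord_holonomy [LieGroup 𝓘(ℝ, 𝔼) ∞ G] {V E : Type*} {P : PrincipalBundle 𝔼 G V} {Γ : DirGraph V E}
    (A : Connection P Γ) {a b : V} (p : GPath Γ a b) :
    (holonomy A p).coord = p.word fun e => (A e).coord := by
  induction p with
  | nil a => exact Transport.coord_id
  | fwd f p ih => rw [holonomy, Transport.coord_comp, ih, GPath.word]
  | bwd f p ih => rw [holonomy, Transport.coord_comp, ih, Transport.coord_inv, GPath.word]

end Holonomy

section MeasurePreserving

variable {𝔼 : Type*} [NormedAddCommGroup 𝔼] [NormedSpace ℝ 𝔼]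
  {G : Type*} [TopologicalSpace G] [ChartedSpace 𝔼 G] [Group G] [MeasurableSpace G]
  [LieGroup 𝓘(ℝ, 𝔼) ∞ G] [BorelSpace G] [CompactSpace G]
  {Vψ Eψ Vφ Eφ : Type*} {ψ : DirGraph Vψ Eψ} {φ : DirGraph Vφ Eφ}

theorem exists_edge_translation {V E : Type*} [DecidableEq E] {Γ : DirGraph V E} {a b : V}
    (p : GPath Γ a b) (h1 : p.edges ≠ []) (h2 : p.edges.Nodup) (g : G) :
    ∃ f ∈ p.edges, ∃ t : G → G,
      MeasurePreserving t (normalizedHaar 𝔼 G) (normalizedHaar 𝔼 G) ∧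
      ∀ x : E → G, p.word (Function.update x f (t (x f))) = p.word x * g := by
  cases p with
  | nil => exact absurd rfl h1
  | fwd f p =>
    refine ⟨f, by simp [GPath.edges], fun y => y * g, measurePreserving_mul_right g, ?_⟩
    intro x
    simp only [GPath.edges, List.nodup_cons] at h2
    simp only [GPath.word, Function.update_self, ← mul_assoc]
    rw [p.word_congr (y := x)]
    intro f' hf'
    rw [Function.update_of_ne]
    rintro rfl
    exact h2.1 hf'
  | bwd f p =>
    refine ⟨f, by simp [GPath.edges], fun y => g⁻¹ * y, measurePreserving_mul_left g⁻¹, ?_⟩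
    intro x
    simp only [GPath.edges, List.nodup_cons] at h2
    simp only [GPath.word, Function.update_self, mul_inv_rev, inv_inv, ← mul_assoc]
    rw [p.word_congr (y := x)]
    intro f' hf'
    rw [Function.update_of_ne]
    rintro rfl
    exact h2.1 hf'

theorem measurePreserving_coord_symm {V : Type*} (P : PrincipalBundle 𝔼 G V) (a b : V) :
    MeasurePreserving (Transport.coordEquiv P a b).symm (normalizedHaar 𝔼 G)
      ((normalizedHaar 𝔼 G).map (Transport.coordEquiv P a b).symm) := by
  refine ⟨?_, rfl⟩
  refine measurable_comap_iff.2 ?_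
  have : Transport.coord ∘ (Transport.coordEquiv P a b).symm = _root_.id := by
    funext g; exact (Transport.coordEquiv P a b).apply_symm_apply g
  rw [this]
  exact measurable_id

theorem measurePreserving_ofCoords {V E : Type*} [Fintype E] (P : PrincipalBundle 𝔼 G V)
    (Γ : DirGraph V E) :
    MeasurePreserving
      (fun (x : E → G) e => (Transport.coordEquiv P (Γ.source e) (Γ.target e)).symm (x e))
      (Measure.pi fun _ => normalizedHaar 𝔼 G) (connectionMeasure P Γ) := by
  have : ∀ e, IsProbabilityMeasure
      ((normalizedHaar 𝔼 G).map (Transport.coordEquiv P (Γ.source e) (Γ.target e)).symm) :=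
    fun e => Measure.isProbabilityMeasure_map
      (measurePreserving_coord_symm P _ _).measurable.aemeasurable
  exact measurePreserving_pi _ _ fun e => measurePreserving_coord_symm P _ _

/-- Right translation of one coordinate of `i^* x` by `g` is induced by a translation of `x`. -/
theorem exists_translation [Fintype Eφ] (i : Inclusion ψ φ) [DecidableEq Eψ] (e : Eψ) (g : G) :
    ∃ T : (Eφ → G) → (Eφ → G),
      MeasurePreserving T (Measure.pi fun _ => normalizedHaar 𝔼 G)
        (Measure.pi fun _ => normalizedHaar 𝔼 G) ∧
      ∀ x, (fun e' => (i.path e').word (T x)) =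
        (fun e' => (i.path e').word x) * Pi.mulSingle e g := by
  classical
  obtain ⟨f, hf, t, ht, hw⟩ := exists_edge_translation (𝔼 := 𝔼) (i.path e) (i.path_simple e).1
    (i.path_simple e).2.1 g
  refine ⟨fun x => Function.update x f (t (x f)), ?_, ?_⟩
  · have h := measurePreserving_pi (fun _ : Eφ => normalizedHaar 𝔼 G)
      (fun _ : Eφ => normalizedHaar 𝔼 G)
      (f := fun f' => if f' = f then t else fun y => y) (by
        intro f'
        by_cases h : f' = f
        · simpa [h] using ht
        · simpa [h] using! MeasurePreserving.id _)
    convert h using 1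
    funext x f'
    by_cases h' : f' = f
    · subst h'; simp
    · simp [h']
  · intro x
    funext e'
    by_cases h : e' = e
    · subst h
      simp [hw]
    · simp only [Pi.mul_apply, Pi.mulSingle_eq_of_ne h, mul_one]
      apply GPath.word_congr
      intro f' hf'
      rw [Function.update_of_ne]
      rintro rfl
      exact h (i.path_disjoint _ _ _ hf' hf)

theorem measurePreserving_words [FiniteDimensional ℝ 𝔼] [Fintype Eψ] [Fintype Eφ] (i : Inclusion ψ φ) :
    MeasurePreserving (fun (x : Eφ → G) (e : Eψ) => (i.path e).word x)
      (Measure.pi fun _ => normalizedHaar 𝔼 G) (Measure.pi fun _ => normalizedHaar 𝔼 G) := by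
  classical
  have : IsTopologicalGroup G := topologicalGroup_of_lieGroup 𝓘(ℝ, 𝔼) ∞
  have : SecondCountableTopology G := ChartedSpace.secondCountable_of_sigmaCompact 𝔼 G
  have := normalizedHaar_isHaarMeasure (𝔼 := 𝔼) (G := G)
  set I : (Eφ → G) → (Eψ → G) := fun x e => (i.path e).word x with hI
  have hIm : Measurable I := measurable_pi_lambda _ fun e => (i.path e).measurable_word
  refine ⟨hIm, ?_⟩
  set μ : Measure (Eφ → G) := Measure.pi fun _ => normalizedHaar 𝔼 G with hμ
  set ν : Measure (Eψ → G) := Measure.pi fun _ => normalizedHaar 𝔼 G with hν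
  have : IsProbabilityMeasure (μ.map I) := Measure.isProbabilityMeasure_map hIm.aemeasurable
  let S : Submonoid (Eψ → G) :=
    { carrier := {h | (μ.map I).map (fun y => y * h) = μ.map I}
      one_mem' := by simp
      mul_mem' := by
        intro h k hh hk
        change (μ.map I).map (fun y => y * (h * k)) = μ.map I
        have : (fun y : Eψ → G => y * (h * k)) = (fun y => y * k) ∘ (fun y => y * h) := by
          funext y; simp [mul_assoc]
        rw [this, ← Measure.map_map (measurable_mul_const k) (measurable_mul_const h)]
        change (μ.map I).map (fun y => y * h) = μ.map I at hh
        change (μ.map I).map (fun y => y * k) = μ.map I at hk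
        rw [hh, hk] }
  have : (μ.map I).IsMulRightInvariant := by
    refine ⟨fun h => ?_⟩
    change h ∈ S
    apply Submonoid.pi_mem_of_mulSingle_mem
    intro e
    change (μ.map I).map (fun y => y * Pi.mulSingle e (h e)) = μ.map I
    obtain ⟨T, hT, hTI⟩ := exists_translation (𝔼 := 𝔼) i e (h e)
    rw [Measure.map_map (measurable_mul_const _) hIm]
    have : (fun y => y * Pi.mulSingle e (h e)) ∘ I = I ∘ T := by
      funext x; exact (hTI x).symm
    rw [this, ← Measure.map_map hIm hT.measurable, hT.map_eq]
  have : ν.IsMulRightInvariant := by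
    refine ⟨fun h => ?_⟩
    have := measurePreserving_pi (fun _ : Eψ => normalizedHaar 𝔼 G)
      (fun _ : Eψ => normalizedHaar 𝔼 G) (f := fun e y => y * h e)
      (fun e => measurePreserving_mul_right (h e))
    exact this.map_eq
  have hprob : ∀ κ : Measure (Eψ → G), IsProbabilityMeasure κ → κ.IsMulRightInvariant →
      κ.inv = ν := by
    intro κ _ _
    have : IsProbabilityMeasure κ.inv :=
      Measure.isProbabilityMeasure_map measurable_inv.aemeasurable
    have : κ.inv.IsHaarMeasure :=
      Measure.isHaarMeasure_of_isCompact_nonempty_interior _ Set.univ isCompact_univ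
        (by simp) (by simp) (by simp)
    exact Measure.isHaarMeasure_eq_of_isProbabilityMeasure _ _
  have h1 := hprob (μ.map I) inferInstance inferInstance
  have h2 := hprob ν inferInstance inferInstance
  rw [← Measure.inv_inv (μ.map I), h1, h2]

namespace Inclusion

variable (P : PrincipalBundle 𝔼 G Vφ) (i : Inclusion ψ φ)

/-- The map `i^* : 𝒜_φ → 𝒜_ψ`: the value of `i^* A` at an edge `e` of `ψ` is the holonomy of `A`
along the path `i(e)`. -/
def pullConnection (A : Connection P φ) : Connection (P.pullback i.vertex) ψ := fun e =>
  { toFun := (holonomy A (i.path e)).toFun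
    smooth := (holonomy A (i.path e)).smooth
    map_smul := (holonomy A (i.path e)).map_smul }

/-- The projection `i^* : 𝒢_φ → 𝒢_ψ`. -/
def pullGauge (g : Gauge P) : Gauge (P.pullback i.vertex) := fun v =>
  { toFun := (g (i.vertex v)).toFun
    smooth := (g (i.vertex v)).smooth
    map_smul := (g (i.vertex v)).map_smul }

theorem coord_pullConnection (A : Connection P φ) (e : Eψ) :
    (i.pullConnection P A e).coord = (i.path e).word fun f => (A f).coord := by
  rw [← coord_holonomy]; rfl

theorem pullConnection_smul (g : Gauge P) (A : Connection P φ) :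
    i.pullConnection P (g • A) = i.pullGauge P g • i.pullConnection P A := by
  funext e
  apply Transport.coord_injective
  have h : (i.pullConnection P (g • A) e).coord = (holonomy (g • A) (i.path e)).coord := rfl
  rw [h, holonomy_smul, smul_apply]
  simp only [Transport.coord_comp, Transport.coord_inv]
  rfl

/-- The measure `μ_φ` pushes forward along `i^*` to the measure `μ_ψ`. -/
theorem measurePreserving_pullConnection [FiniteDimensional ℝ 𝔼] [Fintype Eψ] [Fintype Eφ] :
    MeasurePreserving (i.pullConnection P) (connectionMeasure P φ)
      (connectionMeasure (P.pullback i.vertex) ψ) := by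
  have : IsTopologicalGroup G := topologicalGroup_of_lieGroup 𝓘(ℝ, 𝔼) ∞
  have : SecondCountableTopology G := ChartedSpace.secondCountable_of_sigmaCompact 𝔼 G
  have hm : Measurable (i.pullConnection P) := by
    refine measurable_pi_lambda _ fun e => measurable_comap_iff.2 ?_
    have : Transport.coord ∘ (fun A => i.pullConnection P A e)
        = (fun x => (i.path e).word x) ∘ fun (A : Connection P φ) f => (A f).coord := by
      funext A; exact i.coord_pullConnection P A e
    rw [this]
    exact (i.path e).measurable_word.comp
      (measurable_pi_lambda _ fun f => measurable_coord.comp (measurable_pi_apply f))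
  refine ⟨hm, ?_⟩
  have h1 := measurePreserving_ofCoords P φ
  have h2 := measurePreserving_ofCoords (P.pullback i.vertex) ψ
  have h3 := measurePreserving_words (𝔼 := 𝔼) (G := G) i
  rw [← h1.map_eq, Measure.map_map hm h1.measurable, ← (h2.comp h3).map_eq]
  congr 1
  funext x e
  apply Transport.coord_injective
  simp only [Function.comp]
  rw [i.coord_pullConnection]
  rw [Transport.coord_coordEquiv_symm]
  congr 1
  funext f
  exact Transport.coord_coordEquiv_symm _ _ _ _

/-- The map `𝒜_φ/𝒢_φ → 𝒜_ψ/𝒢_ψ` induced by `i^*`. -/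
def pullModuli : ModuliSpace P φ → ModuliSpace (P.pullback i.vertex) ψ :=
  Quotient.lift (fun A => toModuli (i.pullConnection P A)) (by
    rintro A B ⟨g, rfl⟩
    refine Quotient.sound ⟨i.pullGauge P g, ?_⟩
    exact (i.pullConnection_smul P g B).symm)

theorem pullModuli_toModuli (A : Connection P φ) :
    i.pullModuli P (toModuli A) = toModuli (i.pullConnection P A) := rfl

theorem measurePreserving_pullModuli [FiniteDimensional ℝ 𝔼] [Fintype Eψ] [Fintype Eφ] :
    MeasurePreserving (i.pullModuli P) (moduliMeasure P φ)
      (moduliMeasure (P.pullback i.vertex) ψ) := by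
  have hA := i.measurePreserving_pullConnection P
  have hm : Measurable (i.pullModuli P) :=
    measurable_from_quotient.2 (measurable_toModuli.comp hA.measurable)
  refine ⟨hm, ?_⟩
  unfold moduliMeasure
  rw [Measure.map_map hm measurable_toModuli, ← hA.map_eq,
    Measure.map_map measurable_toModuli hA.measurable]
  rfl

/-- The isometry `i : L²(𝒜_ψ/𝒢_ψ) → L²(𝒜_φ/𝒢_φ)` given by composition with `i^*`. -/
def isometry [FiniteDimensional ℝ 𝔼] [Fintype Eψ] [Fintype Eφ] : L2 (P.pullback i.vertex) ψ →ₗᵢ[ℂ] L2 P φ :=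
  Lp.compMeasurePreservingₗᵢ ℂ (i.pullModuli P) (i.measurePreserving_pullModuli P)

end Inclusion

end MeasurePreserving

/-! ### Irreducible unitary representations -/

section Representations

/-- A (finite-dimensional, continuous) irreducible unitary representation of `G`. -/
structure UnitaryIrrep (G : Type*) [TopologicalSpace G] [Group G] where
  space : Type
  [normed : NormedAddCommGroup space]
  [innerProduct : InnerProductSpace ℂ space]
  [finiteDimensional : FiniteDimensional ℂ space]
  rep : Representation ℂ G space
  inner_rep : ∀ (g : G) (x y : space), inner ℂ (rep g x) (rep g y) = inner ℂ x y
  continuous_rep : ∀ x : space, Continuous fun g => rep g x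
  irreducible : rep.IsIrreducible

attribute [instance] UnitaryIrrep.normed UnitaryIrrep.innerProduct UnitaryIrrep.finiteDimensional

variable {G : Type*} [TopologicalSpace G] [Group G]

/-- Unitary equivalence of representations. -/
def UnitaryIrrep.Equivalent (π σ : UnitaryIrrep G) : Prop :=
  ∃ U : π.space ≃ₗᵢ[ℂ] σ.space, ∀ (g : G) (x : π.space), U (π.rep g x) = σ.rep g (U x)

/-- The trivial representation of `G` on `ℂ`. -/
def UnitaryIrrep.trivial (G : Type*) [TopologicalSpace G] [Group G] : UnitaryIrrep G where
  space := ℂ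
  rep := Representation.trivial ℂ G ℂ
  inner_rep _ _ _ := rfl
  continuous_rep _ := continuous_const
  irreducible :=
    { exists_pair_ne := ⟨⊥, ⊤, fun h => by
        have h1 : (1 : ℂ) ∈ (⊥ : Subrepresentation (Representation.trivial ℂ G ℂ)) := by
          rw [h]; exact Submodule.mem_top
        exact one_ne_zero ((Submodule.mem_bot ℂ).1 h1)⟩
      eq_bot_or_eq_top := fun W => by
        rcases eq_bot_or_eq_top W.toSubmodule with h | h
        · left; exact Subrepresentation.toSubmodule_injective h
        · right; exact Subrepresentation.toSubmodule_injective h }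

/-- `Λ` contains exactly one representative of each equivalence class of irreducible unitary
representations of `G`, and the trivial representation on `ℂ` is one of them. -/
def IsIrrepTransversal (Λ : Set (UnitaryIrrep G)) : Prop :=
  (∀ π : UnitaryIrrep G, ∃! σ, σ ∈ Λ ∧ π.Equivalent σ) ∧ UnitaryIrrep.trivial G ∈ Λ

/-- The tensor product of a family of representations. -/
def piTensorRep {ι : Type*} {W : ι → Type*} [∀ j, AddCommGroup (W j)] [∀ j, Module ℂ (W j)]
    (π : ∀ j, Representation ℂ G (W j)) : Representation ℂ G (⨂[ℂ] j, W j) where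
  toFun g := PiTensorProduct.map fun j => π j g
  map_one' := by simp [Module.End.one_eq_id]
  map_mul' g h := by simp [Module.End.mul_eq_comp, PiTensorProduct.map_comp]

/-! ### Spin network states -/

variable {V E : Type*} (Γ : DirGraph V E) (ρ : E → UnitaryIrrep G)

/-- The set `S(v)` of the edges with source `v`. -/
abbrev Outgoing (v : V) : Type _ := {e : E // Γ.source e = v}

/-- The set `T(v)` of the edges with target `v`. -/
abbrev Incoming (v : V) : Type _ := {e : E // Γ.target e = v}

/-- The vector space `⨂_{e ∈ S(v)} ρ_e ⊗ ⨂_{e ∈ T(v)} ρ_e^*`. -/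
abbrev VertexSpace (v : V) : Type _ :=
  (⨂[ℂ] e : Outgoing Γ v, (ρ e).space) ⊗[ℂ] (⨂[ℂ] e : Incoming Γ v, Dual ℂ (ρ e).space)

/-- The representation of `G` on `⨂_{e ∈ S(v)} ρ_e ⊗ ⨂_{e ∈ T(v)} ρ_e^*`. -/
def vertexRep (v : V) : Representation ℂ G (VertexSpace Γ ρ v) :=
  (piTensorRep fun e : Outgoing Γ v => (ρ e).rep).tprod
    (piTensorRep fun e : Incoming Γ v => (ρ e).rep.dual)

/-- The space `Inv(v, ρ)`. -/
def Inv (v : V) : Submodule ℂ (VertexSpace Γ ρ v) := (vertexRep Γ ρ v).invariants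

/-- The index set of the standard orthonormal basis of `ρ_e`. -/
abbrev BasisIndex (e : E) : Type := Fin (finrank ℂ (ρ e).space)

/-- An orthonormal basis of the space of `ρ_e`. -/
def edgeBasis (e : E) : Basis (BasisIndex ρ e) ℂ (ρ e).space :=
  (stdOrthonormalBasis ℂ (ρ e).space).toBasis

variable [Fintype E]

open scoped Classical in
/-- The basis of `⨂_{e ∈ S(v)} ρ_e ⊗ ⨂_{e ∈ T(v)} ρ_e^*` formed by the tensor products of the
basis vectors `b_j` of the `ρ_e` and the dual basis vectors `b^j` of the `ρ_e^*`. -/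
def vertexBasis (v : V) :
    Basis ((∀ e : Outgoing Γ v, BasisIndex ρ e) × (∀ e : Incoming Γ v, BasisIndex ρ e)) ℂ
      (VertexSpace Γ ρ v) :=
  (Basis.piTensorProduct fun e : Outgoing Γ v => edgeBasis ρ e).tensorProduct
    (Basis.piTensorProduct fun e : Incoming Γ v => (edgeBasis ρ e).dualBasis)

open scoped Classical in
/-- The function of `x ∈ G^E` that corresponds to the family `ι`: the image of `⨂_v ι_v` under
`⨂_v (⨂_{e ∈ S(v)} ρ_e ⊗ ⨂_{e ∈ T(v)} ρ_e^*) ≅ ⨂_e (ρ_e ⊗ ρ_e^*) ⊆ L²(G^E)`, where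
`ξ ⊗ η ∈ ρ_e ⊗ ρ_e^*` is the function `√(dim ρ_e) η(ρ_e(x_e) ξ)` on `G`. It is written in terms of
the bases above; it does not depend on their choice. -/
def spinNetworkAmplitude [Fintype V] (ι : ∀ v, VertexSpace Γ ρ v) (x : E → G) : ℂ :=
  (∏ e, (Real.sqrt (finrank ℂ (ρ e).space) : ℂ)) *
    ∑ k : ∀ e, BasisIndex ρ e, ∑ l : ∀ e, BasisIndex ρ e,
      (∏ v, (vertexBasis Γ ρ v).repr (ι v) (fun e => k e, fun e => l e)) *
        ∏ e, (edgeBasis ρ e).coord (l e) ((ρ e).rep (x e) (edgeBasis ρ e (k e)))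

end Representations

section States

variable {𝔼 : Type*} [NormedAddCommGroup 𝔼] [NormedSpace ℝ 𝔼]
  {G : Type*} [TopologicalSpace G] [ChartedSpace 𝔼 G] [Group G] [MeasurableSpace G]
  [LieGroup 𝓘(ℝ, 𝔼) ∞ G] [BorelSpace G] [CompactSpace G]
  {V E : Type*} [Fintype V] [Fintype E] {P : PrincipalBundle 𝔼 G V} {Γ : DirGraph V E}

/-- `Ψ ∈ L²(𝒜/𝒢)` is a spin network state `Ψ_{ρ,ι}` for some labelling `ρ` of the edges by elements
of `Λ` and some labelling `ι` of the vertices by vectors `ι_v ∈ Inv(v, ρ)`. -/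
def IsSpinNetworkState (Λ : Set (UnitaryIrrep G)) (Ψ : L2 P Γ) : Prop :=
  ∃ ρ : E → UnitaryIrrep G, (∀ e, ρ e ∈ Λ) ∧ ∃ ι : ∀ v, Inv Γ ρ v,
    (fun A : Connection P Γ => Ψ (toModuli A)) =ᵐ[connectionMeasure P Γ]
      fun A => spinNetworkAmplitude Γ ρ (fun v => ι v) fun e => (A e).coord

end States

end SpinNetwork

end

set_option linter.unusedSectionVars false

/-! In trivializations, Ψ becomes a gauge invariant function F on G^{Eψ}, and the hypothesis says
that F, composed with the holonomies along the paths i(e), is almost everywhere a spin network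
amplitude Φ on G^{Eφ}. Three things are needed: labels for the edges of ψ, a product structure over
its vertices, and invariance of the tensors there.

Labels. Translating the variable of the first edge f(e) of i(e) multiplies the holonomy along i(e)
on the right by an arbitrary group element. The paths share no edges, so this can be done for all e
independently. By Fubini there is one base point x₀ such that F agrees almost everywhere with the
values of Φ at the translates of x₀. Hence F has a continuous version F' that is a linear
combination of products of matrix coefficients, with a single irreducible representation σ_e on each
edge: the representative in Λ of ρ_{f(e)} or of its conjugate (`exists_sum_coefficients`).

Tensors. By Schur orthogonality F' is determined by its integrals against products of coefficients
of the σ_e. Since the holonomies push Haar measure to Haar measure, these are integrals over G^{Eφ}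
of Φ against coefficients of σ_e at the holonomies. Expanding the latter along the paths puts an
index on each end of every edge, with matching conditions at the vertices. On a single edge, Schur's
lemma splits the integral into a function of the indices at the source times a function of those at
the target, so the whole integral is a product over the vertices of φ
(`exists_integral_contraction_eq_prod`). Vertices outside the image of ψ contribute constants, which
are absorbed at one vertex of ψ (`exists_local_factors`).

Invariance. By continuity F' is gauge invariant everywhere. Averaging over G^{Vψ} acts on each
vertex tensor separately and makes it invariant (`exists_invariant_tensors`). -/

noncomputable section

namespace SpinNetwork

/-! ### Matrix coefficients of irreducible unitary representations -/

namespace UnitaryIrrep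

section Matrices

variable {G : Type*} [TopologicalSpace G] [Group G]

/-- The standard orthonormal basis of the space of an irreducible representation. -/
abbrev onb (σ : UnitaryIrrep G) : OrthonormalBasis (Fin (finrank ℂ σ.space)) ℂ σ.space :=
  stdOrthonormalBasis ℂ σ.space

/-- The matrix of `σ(x)` in a basis. -/
def matrixIn (σ : UnitaryIrrep G) {ι : Type*} [Fintype ι] [DecidableEq ι]
    (b : Basis ι ℂ σ.space) : G →* Matrix ι ι ℂ where
  toFun x := LinearMap.toMatrix b b (σ.rep x)
  map_one' := by simp [Module.End.one_eq_id]
  map_mul' x y := by rw [map_mul, LinearMap.toMatrix_mul]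

/-- The matrix of `σ(x)` in the standard orthonormal basis. -/
def mat (σ : UnitaryIrrep G) :
    G →* Matrix (Fin (finrank ℂ σ.space)) (Fin (finrank ℂ σ.space)) ℂ :=
  σ.matrixIn σ.onb.toBasis

theorem matrixIn_apply (σ : UnitaryIrrep G) {ι : Type*} [Fintype ι] [DecidableEq ι]
    (b : Basis ι ℂ σ.space) (x : G) (l k : ι) :
    σ.matrixIn b x l k = b.coord l (σ.rep x (b k)) := by
  simp [matrixIn, LinearMap.toMatrix_apply]

theorem mat_apply (σ : UnitaryIrrep G) (x : G) (l k) :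
    σ.mat x l k = inner ℂ (σ.onb l) (σ.rep x (σ.onb k)) := by
  simp [mat, matrixIn_apply, OrthonormalBasis.repr_apply_apply]

theorem continuous_matrixIn (σ : UnitaryIrrep G) {ι : Type*} [Fintype ι] [DecidableEq ι]
    (b : Basis ι ℂ σ.space) (l k : ι) : Continuous fun x => σ.matrixIn b x l k := by
  simp only [matrixIn_apply]
  exact (LinearMap.continuous_of_finiteDimensional (b.coord l)).comp (σ.continuous_rep _)

theorem continuous_mat (σ : UnitaryIrrep G) (l k) : Continuous fun x => σ.mat x l k :=
  σ.continuous_matrixIn _ l k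

/-- Unitarity turns complex conjugation into inversion, which gives integrals against conjugated
coefficients the form required by Schur's lemma. -/
theorem star_mat (σ : UnitaryIrrep G) (x : G) (l k) :
    star (σ.mat x l k) = σ.mat x⁻¹ k l := by
  rw [mat_apply, mat_apply, ← σ.inner_rep x (σ.onb k), ← Module.End.mul_apply, ← map_mul]
  simp

theorem conjTranspose_mat (σ : UnitaryIrrep G) (x : G) :
    (σ.mat x).conjTranspose = σ.mat x⁻¹ := by
  ext l k
  rw [Matrix.conjTranspose_apply, star_mat]

theorem finrank_pos (σ : UnitaryIrrep G) : 0 < finrank ℂ σ.space := by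
  by_contra h
  have h0 : finrank ℂ σ.space = 0 := by omega
  have := σ.irreducible
  have hs : Subsingleton σ.space := finrank_zero_iff.1 h0
  obtain ⟨U, W, hUW⟩ := exists_pair_ne (Subrepresentation σ.rep)
  exact hUW (Subrepresentation.toSubmodule_injective (Subsingleton.elim _ _))

/-- The complex conjugate of a representation, on the space of coordinate vectors. -/
def conjRep (σ : UnitaryIrrep G) :
    Representation ℂ G (EuclideanSpace ℂ (Fin (finrank ℂ σ.space))) where
  toFun x := Matrix.toEuclideanLin ((σ.mat x).map star)
  map_one' := by
    ext v
    simp [Matrix.map_one]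
  map_mul' x y := by
    ext v i
    simp [Matrix.toLpLin_apply, Matrix.mulVec_mulVec]

theorem conjRep_apply (σ : UnitaryIrrep G) (x : G) (v i) :
    σ.conjRep x v i = ∑ j, star (σ.mat x i j) * v j := rfl

/-- The conjugate-linear map from the space of `σ` to the space of the conjugate
representation. -/
def conjVec (σ : UnitaryIrrep G) (v : σ.space) : EuclideanSpace ℂ (Fin (finrank ℂ σ.space)) :=
  WithLp.toLp 2 fun i => star (σ.onb.repr v i)

theorem conjVec_apply (σ : UnitaryIrrep G) (v : σ.space) (i) :
    σ.conjVec v i = star (σ.onb.repr v i) := rfl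

theorem conjVec_surjective (σ : UnitaryIrrep G) : Function.Surjective σ.conjVec := by
  intro w
  refine ⟨σ.onb.repr.symm (WithLp.toLp 2 fun i => star (w i)), ?_⟩
  ext i
  simp [conjVec_apply]

theorem conjVec_eq_zero (σ : UnitaryIrrep G) (v : σ.space) : σ.conjVec v = 0 ↔ v = 0 := by
  constructor
  · intro h
    apply σ.onb.repr.injective
    ext i
    have := congrArg (fun w => w i) h
    simpa [conjVec_apply] using this
  · rintro rfl
    ext i
    simp [conjVec_apply]

theorem conjVec_add (σ : UnitaryIrrep G) (v w : σ.space) :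
    σ.conjVec (v + w) = σ.conjVec v + σ.conjVec w := by
  ext i; simp [conjVec_apply]

theorem conjVec_smul (σ : UnitaryIrrep G) (c : ℂ) (v : σ.space) :
    σ.conjVec (c • v) = star c • σ.conjVec v := by
  ext i; simp [conjVec_apply]

theorem conjVec_rep (σ : UnitaryIrrep G) (x : G) (v : σ.space) :
    σ.conjVec (σ.rep x v) = σ.conjRep x (σ.conjVec v) := by
  ext i
  rw [conjRep_apply, conjVec_apply]
  have h := LinearMap.toMatrix_mulVec_repr σ.onb.toBasis σ.onb.toBasis (σ.rep x) v
  have h' := congrFun h i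
  simp only [Matrix.mulVec, dotProduct, OrthonormalBasis.coe_toBasis_repr_apply] at h'
  rw [← h', star_sum]
  refine Finset.sum_congr rfl fun j _ => ?_
  rw [star_mul', conjVec_apply]
  rfl

/-- `conjVec` is an equivariant conjugate-linear bijection, so preimages of subrepresentations under
it are subrepresentations of σ. -/
theorem conjRep_isIrreducible (σ : UnitaryIrrep G) : σ.conjRep.IsIrreducible := by
  have hσ := σ.irreducible
  refine { exists_pair_ne := ⟨⊥, ⊤, fun h => ?_⟩, eq_bot_or_eq_top := fun W => ?_ }
  · have h1 : (EuclideanSpace.single ⟨0, σ.finrank_pos⟩ 1 : EuclideanSpace ℂ _) ∈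
        (⊥ : Subrepresentation σ.conjRep) := by
      rw [h]; exact Submodule.mem_top
    have h2 := congrArg (fun w => w ⟨0, σ.finrank_pos⟩) ((Submodule.mem_bot ℂ).1 h1)
    simp at h2
  · let W' : Subrepresentation σ.rep :=
      { toSubmodule :=
          { carrier := {v | σ.conjVec v ∈ W.toSubmodule}
            add_mem' := fun {v w} hv hw => by
              rw [Set.mem_ofPred_eq, conjVec_add]
              exact W.toSubmodule.add_mem hv hw
            zero_mem' := by
              rw [Set.mem_ofPred_eq, (σ.conjVec_eq_zero 0).2 rfl]
              exact W.toSubmodule.zero_mem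
            smul_mem' := fun c v hv => by
              rw [Set.mem_ofPred_eq, conjVec_smul]
              exact W.toSubmodule.smul_mem _ hv }
        apply_mem_toSubmodule := fun g v hv => by
          change σ.conjVec (σ.rep g v) ∈ W.toSubmodule
          rw [conjVec_rep]
          exact W.apply_mem_toSubmodule g hv }
    have hW' : ∀ v, v ∈ W'.toSubmodule ↔ σ.conjVec v ∈ W.toSubmodule := fun v => Iff.rfl
    rcases hσ.eq_bot_or_eq_top W' with h | h
    · left
      apply Subrepresentation.toSubmodule_injective
      refine (Submodule.eq_bot_iff _).2 fun w hw => ?_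
      obtain ⟨v, rfl⟩ := σ.conjVec_surjective w
      rw [← hW', h] at hw
      rw [conjVec_eq_zero]
      exact (Submodule.mem_bot ℂ).1 hw
    · right
      apply Subrepresentation.toSubmodule_injective
      refine Submodule.eq_top_iff'.2 fun w => ?_
      obtain ⟨v, rfl⟩ := σ.conjVec_surjective w
      rw [← hW', h]
      exact Submodule.mem_top

/-- The complex conjugate of an irreducible unitary representation. -/
def conj (σ : UnitaryIrrep G) : UnitaryIrrep G where
  space := EuclideanSpace ℂ (Fin (finrank ℂ σ.space))
  rep := σ.conjRep
  inner_rep g x y := by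
    have hu : ((σ.mat g).map star).conjTranspose * (σ.mat g).map star = 1 := by
      have h1 : (σ.mat g).conjTranspose * σ.mat g = 1 := by
        rw [conjTranspose_mat, ← map_mul, inv_mul_cancel, map_one]
      have h2 := congrArg (fun M => Matrix.map M (starRingEnd ℂ)) h1
      simp only [Matrix.map_mul] at h2
      rw [Matrix.map_one _ (map_zero _) (map_one _)] at h2
      exact h2
    change inner ℂ (Matrix.toEuclideanLin ((σ.mat g).map star) x)
      (Matrix.toEuclideanLin ((σ.mat g).map star) y) = _
    rw [← LinearMap.adjoint_inner_right, ← Matrix.toEuclideanLin_conjTranspose_eq_adjoint]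
    congr 1
    simp only [Matrix.toLpLin_apply, Matrix.mulVec_mulVec, hu, Matrix.one_mulVec]
  continuous_rep v := by
    refine (PiLp.continuous_toLp 2 _).comp (continuous_pi fun i => ?_)
    change Continuous fun x => ∑ j, star (σ.mat x i j) * v j
    exact continuous_finsetSum _ fun j _ => ((σ.continuous_mat i j).star).mul continuous_const
  irreducible := σ.conjRep_isIrreducible

/-- The standard basis of the space of the conjugate representation. -/
def conjBasis (σ : UnitaryIrrep G) : Basis (Fin (finrank ℂ σ.space)) ℂ σ.conj.space :=
  (EuclideanSpace.basisFun (Fin (finrank ℂ σ.space)) ℂ).toBasis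

/-- This is how inverses are handled: entries of σ at x⁻¹ are entries of the conjugate
representation at x. They occur for edges that a path traverses backwards. -/
theorem matrixIn_conj (σ : UnitaryIrrep G) (x : G) (l k) :
    σ.conj.matrixIn σ.conjBasis x l k = σ.mat x⁻¹ k l := by
  rw [← star_mat, matrixIn_apply]
  change (EuclideanSpace.basisFun (Fin (finrank ℂ σ.space)) ℂ).toBasis.coord l
    (σ.conjRep x ((EuclideanSpace.basisFun (Fin (finrank ℂ σ.space)) ℂ).toBasis k)) = _
  simp [conjRep_apply, PiLp.single_apply]

/-! ### Schur's lemma -/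

/-- Schur's lemma as a dimension bound, which treats equivalent and inequivalent pairs alike (`U =
0` in the latter case). A nonzero intertwiner f is bijective, and f⁻¹ followed after any other
intertwiner f' is an endomorphism of σ, hence a scalar over ℂ. -/
theorem exists_intertwiner (π σ : UnitaryIrrep G) {m n : Type*} [Fintype m] [DecidableEq m]
    [Fintype n] [DecidableEq n] (b : Basis m ℂ π.space) (b' : Basis n ℂ σ.space) :
    ∃ U : Matrix m n ℂ, ∀ M : Matrix m n ℂ,
      (∀ x, π.matrixIn b x * M = M * σ.matrixIn b' x) → ∃ c : ℂ, M = c • U := by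
  have hπ := π.irreducible
  have hσ := σ.irreducible
  have key : ∀ M : Matrix m n ℂ, (∀ x, π.matrixIn b x * M = M * σ.matrixIn b' x) →
      ∃ f : σ.rep.IntertwiningMap π.rep, LinearMap.toMatrix b' b f.toLinearMap = M := by
    intro M hM
    refine ⟨⟨Matrix.toLin b' b M, fun x => ?_⟩, LinearMap.toMatrix_toLin b' b M⟩
    apply (LinearMap.toMatrix b' b).injective
    rw [LinearMap.toMatrix_comp b' b' b, LinearMap.toMatrix_comp b' b b,
      LinearMap.toMatrix_toLin]
    exact (hM x).symm
  by_cases h : ∃ f : σ.rep.IntertwiningMap π.rep, f ≠ 0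
  · obtain ⟨f, hf⟩ := h
    have hbij := (Representation.IsIrreducible.bijective_or_eq_zero f).resolve_right hf
    refine ⟨LinearMap.toMatrix b' b f.toLinearMap, fun M hM => ?_⟩
    obtain ⟨f', rfl⟩ := key M hM
    let E := Representation.IntertwiningMap.ofBijective f hbij
    obtain ⟨c, hc⟩ :=
      (Representation.IsIrreducible.algebraMap_intertwiningMap_bijective_of_isAlgClosed
        (ρ := σ.rep)).surjective (E.symm.toIntertwiningMap.comp f')
    refine ⟨c, ?_⟩
    rw [← map_smul]
    congr 1
    ext v
    have h1 := congrArg (fun g => f (g v)) hc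
    have h2 : f (E.symm (f' v)) = f' v := E.apply_symm_apply (f' v)
    have h3 : f (E.symm.toIntertwiningMap.comp f' v) = f' v := h2
    have h4 : algebraMap ℂ (σ.rep.IntertwiningMap σ.rep) c v = c • v := by
      rw [Algebra.algebraMap_eq_smul_one]; rfl
    rw [h3, h4] at h1
    have h5 : f (c • v) = c • f v := f.toLinearMap.map_smul c v
    rw [h5] at h1
    exact h1.symm
  · push Not at h
    refine ⟨0, fun M hM => ⟨0, ?_⟩⟩
    obtain ⟨f, rfl⟩ := key M hM
    rw [h f]
    simp

/-- The identity matrix is itself an intertwiner, hence a nonzero multiple of the generator `U`. -/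
theorem exists_scalar (σ : UnitaryIrrep G) (M : Matrix _ _ ℂ)
    (hM : ∀ x, σ.mat x * M = M * σ.mat x) : ∃ c : ℂ, M = c • (1 : Matrix _ _ ℂ) := by
  obtain ⟨U, hU⟩ := exists_intertwiner σ σ σ.onb.toBasis σ.onb.toBasis
  obtain ⟨c, hc⟩ := hU M hM
  obtain ⟨d, hd⟩ := hU 1 (fun x => by simp)
  have hd0 : d ≠ 0 := by
    rintro rfl
    have := congrFun (congrFun hd ⟨0, σ.finrank_pos⟩) ⟨0, σ.finrank_pos⟩
    simp at this
  refine ⟨c * d⁻¹, ?_⟩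
  rw [hd, smul_smul, mul_assoc, inv_mul_cancel₀ hd0, mul_one, hc]

end Matrices
end UnitaryIrrep

namespace UnitaryIrrep

section Coefficients

variable {G : Type*} [TopologicalSpace G] [Group G]

/-- The linear combinations of the matrix coefficients of an irreducible representation. -/
def IsCoeff (σ : UnitaryIrrep G) (f : G → ℂ) : Prop :=
  ∃ c : Matrix _ _ ℂ, ∀ x, f x = (c * σ.mat x).trace

/-- Under the trace, the transition matrices of a change of basis can be moved into c; thus
`IsCoeff` is independent of the basis. -/
theorem isCoeff_of_matrixIn (σ : UnitaryIrrep G) {ι : Type*} [Fintype ι] [DecidableEq ι]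
    (b : Basis ι ℂ σ.space) {f : G → ℂ} (c : Matrix ι ι ℂ)
    (hf : ∀ x, f x = (c * σ.matrixIn b x).trace) : σ.IsCoeff f := by
  have key : ∀ x, σ.matrixIn b x
      = b.toMatrix σ.onb.toBasis * σ.mat x * σ.onb.toBasis.toMatrix b := fun x =>
    (basis_toMatrix_mul_linearMap_toMatrix_mul_basis_toMatrix b σ.onb.toBasis b σ.onb.toBasis
      (σ.rep x)).symm
  refine ⟨σ.onb.toBasis.toMatrix b * c * b.toMatrix σ.onb.toBasis, fun x => ?_⟩
  rw [hf, key, ← Matrix.mul_assoc, Matrix.trace_mul_comm]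
  simp only [Matrix.mul_assoc]

theorem IsCoeff.of_equivalent {π σ : UnitaryIrrep G} (h : π.Equivalent σ) {f : G → ℂ}
    (hf : π.IsCoeff f) : σ.IsCoeff f := by
  obtain ⟨U, hU⟩ := h
  obtain ⟨c, hc⟩ := hf
  refine σ.isCoeff_of_matrixIn (π.onb.toBasis.map U.toLinearEquiv) c fun x => ?_
  rw [hc]
  congr 2
  ext l k
  rw [mat, matrixIn_apply, matrixIn_apply]
  have : σ.rep x (U (π.onb.toBasis k)) = U (π.rep x (π.onb.toBasis k)) := (hU _ _).symm
  simp [Basis.map_apply] at this ⊢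
  rw [this]
  simp

theorem isCoeff_mat_mul (σ : UnitaryIrrep G) (a : G) (l k) :
    σ.IsCoeff fun x => σ.mat (a * x) l k := by
  refine ⟨Matrix.single k l 1 * σ.mat a, fun x => ?_⟩
  rw [mul_assoc, ← map_mul, Matrix.trace_mul_comm, Matrix.trace_mul_single]
  simp

/-- In the expansion of σ(x⁻¹)σ(a) the entries of σ(a) are constants, and those of σ(x⁻¹) belong to
the conjugate representation. -/
theorem isCoeff_conj_mat_inv_mul (σ : UnitaryIrrep G) (a : G) (l k) :
    σ.conj.IsCoeff fun x => σ.mat (x⁻¹ * a) l k := by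
  refine σ.conj.isCoeff_of_matrixIn σ.conjBasis
    (Matrix.of fun i j => if i = l then σ.mat a j k else 0) fun x => ?_
  simp [Matrix.trace, Matrix.mul_apply, matrixIn_conj, mul_comm]

theorem IsCoeff.continuous {σ : UnitaryIrrep G} {f : G → ℂ} (hf : σ.IsCoeff f) :
    Continuous f := by
  obtain ⟨c, hc⟩ := hf
  have : f = fun x => ∑ i, ∑ j, c i j * σ.mat x j i := by
    funext x
    rw [hc]
    simp [Matrix.trace, Matrix.mul_apply]
  rw [this]
  exact continuous_finsetSum _ fun i _ => continuous_finsetSum _ fun j _ =>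
    continuous_const.mul (σ.continuous_mat _ _)

end Coefficients

/-! ### Integrals of products of matrix coefficients. -/

section Integrals

variable {G : Type*} [TopologicalSpace G] [Group G] [IsTopologicalGroup G] [CompactSpace G]
  [MeasurableSpace G] [BorelSpace G] (μ : Measure G) [IsProbabilityMeasure μ]
  [μ.IsMulLeftInvariant]

theorem integrable_of_continuous {X : Type*} [TopologicalSpace X] [CompactSpace X]
    [MeasurableSpace X] [OpensMeasurableSpace X] (ν : Measure X) [IsFiniteMeasure ν]
    {f : X → ℂ} (hf : Continuous f) : Integrable f ν :=
  hf.integrable_of_hasCompactSupport (HasCompactSupport.of_compactSpace f)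

/-- For fixed k and l' the matrix of integrals is the average of π(x) E σ(x⁻¹), where E is the
elementary matrix at (k, l'). The substitution x ↦ g x shows that it intertwines. -/
theorem integral_intertwines (π σ : UnitaryIrrep G) {m n : Type*} [Fintype m] [DecidableEq m]
    [Fintype n] [DecidableEq n] (b : Basis m ℂ π.space) (b' : Basis n ℂ σ.space) (k : m) (l' : n)
    (g : G) :
    π.matrixIn b g *
        Matrix.of (fun l k' => ∫ x, π.matrixIn b x l k * σ.matrixIn b' x⁻¹ l' k' ∂μ) =
      Matrix.of (fun l k' => ∫ x, π.matrixIn b x l k * σ.matrixIn b' x⁻¹ l' k' ∂μ) *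
        σ.matrixIn b' g := by
  have hint : ∀ l k', Integrable (fun x => π.matrixIn b x l k * σ.matrixIn b' x⁻¹ l' k') μ :=
    fun l k' => integrable_of_continuous μ ((π.continuous_matrixIn b l k).mul
      ((σ.continuous_matrixIn b' l' k').comp continuous_inv))
  ext l k'
  simp only [Matrix.mul_apply, Matrix.of_apply]
  simp_rw [← integral_const_mul, ← integral_mul_const]
  rw [← integral_finsetSum _ fun j _ => (hint j k').const_mul _,
    ← integral_finsetSum _ fun j _ => (hint l j).mul_const _,
    ← integral_mul_left_eq_self (fun x => ∑ i, π.matrixIn b x l k * σ.matrixIn b' x⁻¹ l' i *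
      σ.matrixIn b' g i k') g]
  congr 1
  funext x
  have h1 : π.matrixIn b (g * x) l k = ∑ j, π.matrixIn b g l j * π.matrixIn b x j k := by
    rw [map_mul, Matrix.mul_apply]
  have h2 : σ.matrixIn b' x⁻¹ l' k' = ∑ i, σ.matrixIn b' (g * x)⁻¹ l' i * σ.matrixIn b' g i k' := by
    rw [← Matrix.mul_apply, ← map_mul]
    simp
  simp_rw [← mul_assoc, ← Finset.sum_mul]
  rw [← h1, h2, Finset.mul_sum]
  simp only [mul_assoc]

/-- The integrals of products of matrix coefficients are products of a function of the row indices
and a function of the column indices. -/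
theorem exists_integral_matrixIn_mul (π σ : UnitaryIrrep G) {m n : Type*} [Fintype m]
    [DecidableEq m] [Fintype n] [DecidableEq n] (b : Basis m ℂ π.space) (b' : Basis n ℂ σ.space) :
    ∃ u : m → n → ℂ, ∃ w : m → n → ℂ, ∀ l k l' k',
      ∫ x, π.matrixIn b x l k * σ.matrixIn b' x⁻¹ l' k' ∂μ = u l k' * w k l' := by
  obtain ⟨U, hU⟩ := exists_intertwiner π σ b b'
  -- All the averages are multiples of one `U`: its entries depend on the outer indices l, k' only,
  -- and the scalar on the inner indices k, l' only.
  choose c hc using fun k l' => hU _ (integral_intertwines μ π σ b b' k l')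
  refine ⟨U, c, fun l k l' k' => ?_⟩
  have := congrFun (congrFun (hc k l') l) k'
  simpa [mul_comm] using this

/-- The form that `exists_integral_matrixIn_mul` takes for the matrices of unitary
representations. -/
theorem exists_integral_mat_mul_star (π σ : UnitaryIrrep G) :
    ∃ u w : Fin (finrank ℂ π.space) → Fin (finrank ℂ σ.space) → ℂ, ∀ l k t s,
      ∫ x, π.mat x l k * star (σ.mat x t s) ∂μ = u l t * w k s := by
  obtain ⟨u, w, h⟩ := exists_integral_matrixIn_mul μ π σ π.onb.toBasis σ.onb.toBasis
  refine ⟨u, w, fun l k t s => ?_⟩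
  simp_rw [star_mat]
  exact h l k s t

/-- The separation of indices for an edge traversed backwards: the conjugate of σ takes the place of
σ. -/
theorem exists_integral_mat_mul_star_inv (π σ : UnitaryIrrep G) :
    ∃ u w : Fin (finrank ℂ π.space) → Fin (finrank ℂ σ.space) → ℂ, ∀ l k t s,
      ∫ x, π.mat x l k * star (σ.mat x⁻¹ s t) ∂μ = u l t * w k s := by
  obtain ⟨u, w, h⟩ := exists_integral_matrixIn_mul μ π σ.conj π.onb.toBasis σ.conjBasis
  refine ⟨u, w, fun l k t s => ?_⟩
  rw [← h l k s t]
  simp_rw [star_mat, matrixIn_conj]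
  rfl

/-- Schur's orthogonality relations. -/
theorem integral_mat_mul_star_mat (σ : UnitaryIrrep G) (l k l' k') :
    (finrank ℂ σ.space : ℂ) * ∫ x, σ.mat x l k * star (σ.mat x l' k') ∂μ
      = if l = l' ∧ k = k' then 1 else 0 := by
  obtain ⟨c, hc⟩ := σ.exists_scalar _
    (integral_intertwines μ σ σ σ.onb.toBasis σ.onb.toBasis k k')
  have hent : ∀ i j, ∫ x, σ.mat x i k * star (σ.mat x j k') ∂μ = if i = j then c else 0 := by
    intro i j
    have := congrFun (congrFun hc i) j
    simp_rw [star_mat]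
    simpa [Matrix.one_apply, mat] using this
  -- The scalar is found from the trace: conjugation by σ(x) preserves the trace of the elementary
  -- matrix, so the average has trace 1 or 0.
  have htr : (finrank ℂ σ.space : ℂ) * c = if k = k' then 1 else 0 := by
    have hint : ∀ j, Integrable (fun x => σ.mat x j k * star (σ.mat x j k')) μ := fun j =>
      integrable_of_continuous μ ((σ.continuous_mat j k).mul (σ.continuous_mat j k').star)
    have h1 : ∑ i, ∫ x, σ.mat x i k * star (σ.mat x i k') ∂μ = (finrank ℂ σ.space : ℂ) * c := by
      rw [Finset.sum_congr rfl fun i _ => hent i i]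
      simp
    rw [← h1, ← integral_finsetSum _ fun j _ => hint j]
    have h2 : ∀ x, ∑ i, σ.mat x i k * star (σ.mat x i k') = if k = k' then 1 else 0 := by
      intro x
      simp_rw [star_mat, mul_comm (σ.mat x _ _)]
      rw [← Matrix.mul_apply, ← map_mul, inv_mul_cancel, map_one, Matrix.one_apply]
      simp only [eq_comm]
    simp only [h2]
    simp
  rw [hent]
  split_ifs <;> simp_all

/-- A linear combination of matrix coefficients is determined by its integrals against them. -/
theorem IsCoeff.eq_sum {σ : UnitaryIrrep G} {f : G → ℂ} (hf : σ.IsCoeff f) (y : G) :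
    ∑ k, ∑ l, ((finrank ℂ σ.space : ℂ) * ∫ x, f x * star (σ.mat x l k) ∂μ) * σ.mat y l k
      = f y := by
  obtain ⟨c, hc⟩ := hf
  have h1 : ∀ x, f x = ∑ i, ∑ j, c i j * σ.mat x j i := by
    intro x
    rw [hc]
    simp [Matrix.trace, Matrix.mul_apply]
  have h2 : ∀ l k, (finrank ℂ σ.space : ℂ) * ∫ x, f x * star (σ.mat x l k) ∂μ = c k l := by
    intro l k
    have hint : ∀ i j, Integrable (fun x => c i j * (σ.mat x j i * star (σ.mat x l k))) μ :=
      fun i j => integrable_of_continuous μ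
        (continuous_const.mul ((σ.continuous_mat j i).mul (σ.continuous_mat l k).star))
    have h3 : ∀ x, f x * star (σ.mat x l k)
        = ∑ i, ∑ j, c i j * (σ.mat x j i * star (σ.mat x l k)) := by
      intro x
      simp only [h1, Finset.sum_mul, mul_assoc]
    simp only [h3]
    rw [integral_finsetSum _ fun i _ => integrable_finsetSum _ fun j _ => hint i j]
    simp only [integral_finsetSum _ fun j _ => hint _ j, integral_const_mul, Finset.mul_sum,
      mul_left_comm _ (c _ _), integral_mat_mul_star_mat]
    simp [ite_and]
  simp_rw [h2]
  exact (h1 y).symm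

end Integrals

end UnitaryIrrep

/-! ### Finite sums over families of indices -/

section Sums

open scoped Classical in
/-- A sum over all families of indices of a product over vertices, each factor of which involves
only the indices at its vertex, is a product of sums. -/
theorem prod_sum_fibres {V E : Type*} [Fintype V] [Fintype E] (s t : E → V) {X Y : E → Type*}
    [∀ e, Fintype (X e)] [∀ e, Fintype (Y e)]
    (f : ∀ v, (∀ e : {e // s e = v}, X e) → (∀ e : {e // t e = v}, Y e) → ℂ) :
    ∏ v, ∑ k, ∑ l, f v k l
      = ∑ k : ∀ e, X e, ∑ l : ∀ e, Y e, ∏ v, f v (fun e => k e) (fun e => l e) := by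
  simp_rw [← Fintype.sum_prod_type']
  rw [Finset.prod_univ_sum, Fintype.piFinset_univ]
  refine (Fintype.sum_equiv
    { toFun := fun (z : (∀ e, X e) × (∀ e, Y e)) v =>
        ((fun e => z.1 e, fun e => z.2 e) :
          (∀ e : {e // s e = v}, X e) × (∀ e : {e // t e = v}, Y e))
      invFun := fun x => (fun e => (x (s e)).1 ⟨e, rfl⟩, fun e => (x (t e)).2 ⟨e, rfl⟩)
      left_inv := fun _ => rfl
      right_inv := fun x => by
        funext v
        refine Prod.ext (funext ?_) (funext ?_)
        · rintro ⟨e, rfl⟩; rfl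
        · rintro ⟨e, rfl⟩; rfl } _ _ fun z => rfl).symm

variable {E A : Type*} [Fintype E] [DecidableEq E] [Fintype A] [DecidableEq A]

/-- The sum of `h` over all families of indices, with the weights `m`. -/
def weightedSum (m : E → A → ℂ) (h : (E → A) → ℂ) : ℂ := ∑ Z : E → A, (∏ f, m f (Z f)) * h Z

/-- A point mass as the weight of f freezes the index of f at z. Sums over the indices of a path are
taken one edge at a time by this device. -/
theorem prod_update_single (m : E → A → ℂ) (f : E) (z : A) (Z : E → A) :
    ∏ f', Function.update m f (Pi.single z 1) f' (Z f')
      = if Z f = z then ∏ f' ∈ Finset.univ.erase f, m f' (Z f') else 0 := by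
  rw [← Finset.mul_prod_erase Finset.univ _ (Finset.mem_univ f), Function.update_self,
    Pi.single_apply]
  have : ∏ f' ∈ Finset.univ.erase f, Function.update m f (Pi.single z 1) f' (Z f')
      = ∏ f' ∈ Finset.univ.erase f, m f' (Z f') := by
    refine Finset.prod_congr rfl fun f' hf' => ?_
    rw [Function.update_of_ne (Finset.ne_of_mem_erase hf')]
  rw [this]
  split_ifs <;> simp

theorem weightedSum_update_single_congr (m : E → A → ℂ) (f : E) (z : A) {h h' : (E → A) → ℂ}
    (H : ∀ Z, Z f = z → h Z = h' Z) :
    weightedSum (Function.update m f (Pi.single z 1)) h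
      = weightedSum (Function.update m f (Pi.single z 1)) h' := by
  refine Finset.sum_congr rfl fun Z _ => ?_
  rw [prod_update_single]
  split_ifs with hz
  · rw [H Z hz]
  · simp

/-- Summation over the index of one edge. -/
theorem weightedSum_eq_sum (m : E → A → ℂ) (f : E) (h : (E → A) → ℂ) :
    weightedSum m h = ∑ z, m f z * weightedSum (Function.update m f (Pi.single z 1)) h := by
  simp only [weightedSum, Finset.mul_sum]
  rw [Finset.sum_comm]
  refine Finset.sum_congr rfl fun Z _ => ?_
  simp only [prod_update_single]
  rw [Finset.sum_eq_single (Z f)]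
  · rw [if_pos rfl, ← mul_assoc, Finset.mul_prod_erase Finset.univ (fun f => m f (Z f))
      (Finset.mem_univ f)]
  · intro z _ hz
    rw [if_neg hz.symm]
    simp
  · simp

/-- Exchanging z and w in the coordinate f permutes the families of indices; neither h nor the
weights of the other edges see the exchange. -/
theorem weightedSum_update_single_eq (m : E → A → ℂ) (f : E) (z w : A) {h : (E → A) → ℂ}
    (H : ∀ Z Z' : E → A, (∀ f' ≠ f, Z f' = Z' f') → h Z = h Z') :
    weightedSum (Function.update m f (Pi.single z 1)) h
      = weightedSum (Function.update m f (Pi.single w 1)) h := by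
  simp only [weightedSum, prod_update_single]
  refine Fintype.sum_equiv (Equiv.piCongrRight fun f' =>
    if f' = f then Equiv.swap z w else Equiv.refl A) _ _ fun Z => ?_
  have h1 : ∀ f' ≠ f, (Equiv.piCongrRight fun f' =>
      if f' = f then Equiv.swap z w else Equiv.refl A) Z f' = Z f' := by
    intro f' hf'
    simp [hf']
  have h2 : (Equiv.piCongrRight fun f' =>
      if f' = f then Equiv.swap z w else Equiv.refl A) Z f = Equiv.swap z w (Z f) := by
    simp
  rw [h2, H Z _ fun f' hf' => (h1 f' hf').symm]
  congr 1
  rw [Finset.prod_congr rfl fun f' hf' =>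
    congrArg (m f') (h1 f' (Finset.ne_of_mem_erase hf')).symm]
  refine if_congr ?_ rfl rfl
  rw [Equiv.swap_apply_eq_iff, Equiv.swap_apply_right]

/-- The weights of an edge of total weight `1` play no role if `h` does not depend on its index. -/
theorem weightedSum_update_single_of_sum_eq_one (m : E → A → ℂ) (f : E) (z : A)
    {h : (E → A) → ℂ} (hm : ∑ w, m f w = 1)
    (H : ∀ Z Z' : E → A, (∀ f' ≠ f, Z f' = Z' f') → h Z = h Z') :
    weightedSum (Function.update m f (Pi.single z 1)) h = weightedSum m h := by
  rw [weightedSum_eq_sum m f, Finset.sum_congr rfl fun w _ => by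
    rw [weightedSum_update_single_eq m f w z H], ← Finset.sum_mul, hm, one_mul]

theorem weightedSum_one (m : E → A → ℂ) : weightedSum m (fun _ => 1) = ∏ f, ∑ z, m f z := by
  rw [Finset.prod_univ_sum, Fintype.piFinset_univ]
  simp [weightedSum]

end Sums

/-! ### Matching of indices along a path. -/

namespace GPath

section Link

variable {V E J : Type*} [DecidableEq V] [DecidableEq J] {Γ : DirGraph V E}

/-- Every edge `f` carries an index `S f` at its source and an index `T f` at its target. The
function `p.link S T k l v` is `1` if, whenever the path `p` passes through `v`, the indices of the
two edges involved agree at `v`, where `k` and `l` are the indices at the ends of the path;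
otherwise it is `0`. -/
def link (S T : E → J) : ∀ {a b : V}, GPath Γ a b → J → J → V → ℂ
  | _, _, nil a, k, l, v => if v = a → k = l then 1 else 0
  | _, _, fwd f p, k, l, v => (if v = Γ.source f → k = S f then 1 else 0) * p.link S T (T f) l v
  | _, _, bwd f p, k, l, v => (if v = Γ.target f → k = T f then 1 else 0) * p.link S T (S f) l v

/-- `p.link S T k l v` depends only on the indices at `v`. -/
theorem link_congr {S T S' T' : E → J} {a b : V} (p : GPath Γ a b) {k l k' l' : J} {v : V}
    (hS : ∀ f, Γ.source f = v → S f = S' f) (hT : ∀ f, Γ.target f = v → T f = T' f)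
    (hk : v = a → k = k') (hl : v = b → l = l') :
    p.link S T k l v = p.link S' T' k' l' v := by
  induction p generalizing k k' with
  | nil a =>
    unfold link
    refine if_congr (forall_congr' fun h => ?_) rfl rfl
    rw [hk h, hl h]
  | fwd f p ih =>
    unfold link
    rw [ih (fun h => hT f h.symm) hl]
    congr 1
    refine if_congr (forall_congr' fun h => ?_) rfl rfl
    rw [hk h, hS f h.symm]
  | bwd f p ih =>
    unfold link
    rw [ih (fun h => hS f h.symm) hl]
    congr 1
    refine if_congr (forall_congr' fun h => ?_) rfl rfl
    rw [hk h, hT f h.symm]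

/-- The product of `p.link S T k l v` over all vertices `v`. -/
def fullLink (Z : E → J × J) : ∀ {a b : V}, GPath Γ a b → J → J → ℂ
  | _, _, nil _, k, l => if k = l then 1 else 0
  | _, _, fwd f p, k, l => (if k = (Z f).1 then 1 else 0) * p.fullLink Z (Z f).2 l
  | _, _, bwd f p, k, l => (if k = (Z f).2 then 1 else 0) * p.fullLink Z (Z f).1 l

theorem prod_ite_imp [Fintype V] (a : V) (P : Prop) [Decidable P] :
    ∏ v, (if v = a → P then (1 : ℂ) else 0) = if P then 1 else 0 := by
  rw [Finset.prod_eq_single a]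
  · simp
  · intro v _ hv
    simp [hv]
  · simp

/-- Each matching condition is imposed at one vertex and is vacuous at all others, so distributing
the conditions over the vertices loses nothing, even at a vertex visited more than once. -/
theorem prod_link [Fintype V] (S T : E → J) {a b : V} (p : GPath Γ a b) (k l : J) :
    ∏ v, p.link S T k l v = p.fullLink (fun f => (S f, T f)) k l := by
  induction p generalizing k with
  | nil a => simp only [link, fullLink, prod_ite_imp]
  | fwd f p ih => simp only [link, fullLink, Finset.prod_mul_distrib, prod_ite_imp, ih]
  | bwd f p ih => simp only [link, fullLink, Finset.prod_mul_distrib, prod_ite_imp, ih]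

theorem fullLink_congr {Z Z' : E → J × J} {a b : V} (p : GPath Γ a b) (k l : J)
    (h : ∀ f ∈ p.edges, Z f = Z' f) : p.fullLink Z k l = p.fullLink Z' k l := by
  induction p generalizing k with
  | nil a => rfl
  | fwd f p ih =>
    simp only [edges, List.mem_cons] at h
    simp only [fullLink, h f (Or.inl rfl), ih _ fun f' hf' => h f' (Or.inr hf')]
  | bwd f p ih =>
    simp only [edges, List.mem_cons] at h
    simp only [fullLink, h f (Or.inl rfl), ih _ fun f' hf' => h f' (Or.inr hf')]

variable [Fintype J]

/-- The product along a path of the matrices `m f (s, t)`, where `s` and `t` are the indices at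
the source and at the target of `f`. -/
def pathMatrix (m : E → J × J → ℂ) : ∀ {a b : V}, GPath Γ a b → Matrix J J ℂ
  | _, _, nil _ => 1
  | _, _, fwd f p => p.pathMatrix m * Matrix.of fun t s => m f (s, t)
  | _, _, bwd f p => p.pathMatrix m * Matrix.of fun s t => m f (s, t)

theorem pathMatrix_congr {m m' : E → J × J → ℂ} {a b : V} (p : GPath Γ a b)
    (h : ∀ f ∈ p.edges, m f = m' f) : p.pathMatrix m = p.pathMatrix m' := by
  induction p with
  | nil a => rfl
  | fwd f p ih =>
    simp only [edges, List.mem_cons] at h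
    simp only [pathMatrix, h f (Or.inl rfl), ih fun f' hf' => h f' (Or.inr hf')]
  | bwd f p ih =>
    simp only [edges, List.mem_cons] at h
    simp only [pathMatrix, h f (Or.inl rfl), ih fun f' hf' => h f' (Or.inr hf')]

variable [Fintype E] [DecidableEq E]

/-- Summation over the indices of the edges of a path. -/
theorem weightedSum_fullLink {a b : V} (p : GPath Γ a b) (hp : p.edges.Nodup) (k l : J)
    (m m' : E → J × J → ℂ) (h : (E → J × J) → ℂ)
    (hh : ∀ Z Z', (∀ f ∉ p.edges, Z f = Z' f) → h Z = h Z')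
    (hm : ∀ f ∉ p.edges, m f = m' f) (hm' : ∀ f ∈ p.edges, ∑ z, m' f z = 1) :
    weightedSum m (fun Z => p.fullLink Z k l * h Z)
      = p.pathMatrix m l k * weightedSum m' h := by
  induction p generalizing k m m' with
  | nil a =>
    have : m = m' := funext fun f => hm f (by simp [edges])
    subst this
    simp only [fullLink, pathMatrix, Matrix.one_apply, weightedSum, Finset.mul_sum, eq_comm,
      mul_left_comm]
  | fwd f p ih =>
    simp only [edges, List.mem_cons, List.nodup_cons, not_or] at hp hh hm hm'
    have key : ∀ z, weightedSum (Function.update m f (Pi.single z 1))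
        (fun Z => (fwd f p).fullLink Z k l * h Z)
          = (if k = z.1 then 1 else 0) * (p.pathMatrix m l z.2 * weightedSum m' h) := by
      intro z
      rw [weightedSum_update_single_congr m f z
        (h' := fun Z => (if k = z.1 then 1 else 0) * (p.fullLink Z z.2 l * h Z))
        (fun Z hZ => by simp only [fullLink, hZ, mul_assoc])]
      -- The index of f is frozen in both weights, so that they still agree off `p`. It is then
      -- released in `m'`, where f has total weight 1 and h does not depend on it.
      have h1 := ih hp.2 z.2 (Function.update m f (Pi.single z 1))
        (Function.update m' f (Pi.single z 1))
        (fun Z Z' H => hh Z Z' fun f' hf' => H f' hf'.2)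
        (fun f' hf' => by
          by_cases hff : f' = f
          · subst hff; simp
          · rw [Function.update_of_ne hff, Function.update_of_ne hff, hm f' ⟨hff, hf'⟩])
        (fun f' hf' => by
          have hff : f' ≠ f := by rintro rfl; exact hp.1 hf'
          rw [Function.update_of_ne hff]
          exact hm' f' (Or.inr hf'))
      rw [weightedSum_update_single_of_sum_eq_one m' f z (hm' f (Or.inl rfl))
        (fun Z Z' H => hh Z Z' fun f' hf' => H f' hf'.1)] at h1
      rw [p.pathMatrix_congr (m' := m) (fun f' hf' => by
        rw [Function.update_of_ne]
        rintro rfl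
        exact hp.1 hf')] at h1
      rw [← h1]
      simp only [weightedSum, Finset.mul_sum]
      exact Finset.sum_congr rfl fun Z _ => by ring
    rw [weightedSum_eq_sum m f, Finset.sum_congr rfl fun z _ => by rw [key z]]
    -- Matching forces the source index of f to be k; the sum over its target index is the matrix
    -- product.
    rw [Fintype.sum_prod_type, Finset.sum_eq_single k]
    · simp only [if_true, one_mul, pathMatrix, Matrix.mul_apply, Matrix.of_apply, Finset.sum_mul]
      exact Finset.sum_congr rfl fun t _ => by ring
    · intro s _ hs
      simp [hs.symm]
    · simp
  | bwd f p ih =>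
    simp only [edges, List.mem_cons, List.nodup_cons, not_or] at hp hh hm hm'
    have key : ∀ z, weightedSum (Function.update m f (Pi.single z 1))
        (fun Z => (bwd f p).fullLink Z k l * h Z)
          = (if k = z.2 then 1 else 0) * (p.pathMatrix m l z.1 * weightedSum m' h) := by
      intro z
      rw [weightedSum_update_single_congr m f z
        (h' := fun Z => (if k = z.2 then 1 else 0) * (p.fullLink Z z.1 l * h Z))
        (fun Z hZ => by simp only [fullLink, hZ, mul_assoc])]
      have h1 := ih hp.2 z.1 (Function.update m f (Pi.single z 1))
        (Function.update m' f (Pi.single z 1))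
        (fun Z Z' H => hh Z Z' fun f' hf' => H f' hf'.2)
        (fun f' hf' => by
          by_cases hff : f' = f
          · subst hff; simp
          · rw [Function.update_of_ne hff, Function.update_of_ne hff, hm f' ⟨hff, hf'⟩])
        (fun f' hf' => by
          have hff : f' ≠ f := by rintro rfl; exact hp.1 hf'
          rw [Function.update_of_ne hff]
          exact hm' f' (Or.inr hf'))
      rw [weightedSum_update_single_of_sum_eq_one m' f z (hm' f (Or.inl rfl))
        (fun Z Z' H => hh Z Z' fun f' hf' => H f' hf'.1)] at h1
      rw [p.pathMatrix_congr (m' := m) (fun f' hf' => by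
        rw [Function.update_of_ne]
        rintro rfl
        exact hp.1 hf')] at h1
      rw [← h1]
      simp only [weightedSum, Finset.mul_sum]
      exact Finset.sum_congr rfl fun Z _ => by ring
    rw [weightedSum_eq_sum m f, Finset.sum_congr rfl fun z _ => by rw [key z]]
    rw [Fintype.sum_prod_type_right, Finset.sum_eq_single k]
    · simp only [if_true, one_mul, pathMatrix, Matrix.mul_apply, Matrix.of_apply, Finset.sum_mul]
      exact Finset.sum_congr rfl fun t _ => by ring
    · intro s _ hs
      simp [hs.symm]
    · simp

end Link

end GPath

/-! ### Several disjoint paths; holonomies as products of edge matrices. -/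

namespace GPath

variable {V E J : Type*} [DecidableEq V] [DecidableEq J] {Γ : DirGraph V E}

theorem star_fullLink (Z : E → J × J) {a b : V} (p : GPath Γ a b) (k l : J) :
    star (p.fullLink Z k l) = p.fullLink Z k l := by
  induction p generalizing k with
  | nil a => simp only [fullLink]; split_ifs <;> simp
  | fwd f p ih => simp only [fullLink, star_mul', ih]; congr 1; split_ifs <;> simp
  | bwd f p ih => simp only [fullLink, star_mul', ih]; congr 1; split_ifs <;> simp

/-- Summation over the indices of the edges of disjoint paths. -/
theorem weightedSum_prod_fullLink [Fintype J] [Nonempty J] [Fintype E] [DecidableEq E]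
    {E' : Type*} {a b : E' → V} (p : ∀ e, GPath Γ (a e) (b e)) (hp : ∀ e, (p e).edges.Nodup)
    (hd : ∀ f e e', f ∈ (p e).edges → f ∈ (p e').edges → e = e') (k l : E' → J)
    (s : Finset E') (m : E → J × J → ℂ)
    (hm : ∀ f, (∀ e ∈ s, f ∉ (p e).edges) → ∑ z, m f z = 1) :
    weightedSum m (fun Z => ∏ e ∈ s, (p e).fullLink Z (k e) (l e))
      = ∏ e ∈ s, (p e).pathMatrix m (l e) (k e) := by
  classical
  induction s using Finset.induction_on generalizing m with
  | empty =>
    simp only [Finset.prod_empty]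
    rw [weightedSum_one]
    exact Finset.prod_eq_one fun f _ => hm f (by simp)
  | insert e s he ih =>
    simp only [Finset.prod_insert he]
    let z₀ : J × J := Classical.arbitrary _
    -- After summation over the path of e, no remaining path uses its edges. Their weights are reset
    -- to an arbitrary point mass, because the induction hypothesis wants total weight 1 on edges
    -- outside the remaining paths.
    let m' : E → J × J → ℂ := fun f => if f ∈ (p e).edges then Pi.single z₀ 1 else m f
    have hne : ∀ e' ∈ s, ∀ f ∈ (p e').edges, f ∉ (p e).edges := by
      intro e' he' f hf hf'
      rw [hd f e' e hf hf'] at he'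
      exact he he'
    have hm'1 : ∀ f ∈ (p e).edges, ∑ z, m' f z = 1 := by
      intro f hf
      simp [m', hf]
    rw [(p e).weightedSum_fullLink (hp e) (k e) (l e) m m' _ ?_ ?_ hm'1, ih m' ?_]
    · congr 1
      refine Finset.prod_congr rfl fun e' he' => ?_
      rw [(p e').pathMatrix_congr (m' := m) fun f hf => by simp [m', hne e' he' f hf]]
    · intro f hf
      by_cases hfe : f ∈ (p e).edges
      · exact hm'1 f hfe
      · simp only [m', hfe, if_false]
        refine hm f fun e' he' => ?_
        rcases Finset.mem_insert.1 he' with rfl | h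
        · exact hfe
        · exact hf e' h
    · intro Z Z' H
      refine Finset.prod_congr rfl fun e' he' => (p e').fullLink_congr _ _ fun f hf => ?_
      exact H f (hne e' he' f hf)
    · intro f hf
      simp [m', hf]

/-- The edges that a path traverses forwards. -/
def fwdEdges : ∀ {a b : V}, GPath Γ a b → List E
  | _, _, nil _ => []
  | _, _, fwd f p => f :: p.fwdEdges
  | _, _, bwd _ p => p.fwdEdges

/-- The edges that a path traverses backwards. -/
def bwdEdges : ∀ {a b : V}, GPath Γ a b → List E
  | _, _, nil _ => []
  | _, _, fwd _ p => p.bwdEdges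
  | _, _, bwd f p => f :: p.bwdEdges

theorem mem_edges_iff {a b : V} (p : GPath Γ a b) (f : E) :
    f ∈ p.edges ↔ f ∈ p.fwdEdges ∨ f ∈ p.bwdEdges := by
  induction p with
  | nil a => simp [edges, fwdEdges, bwdEdges]
  | fwd f p ih => simp [edges, fwdEdges, bwdEdges, ih, or_assoc]
  | bwd f p ih => simp [edges, fwdEdges, bwdEdges, ih, or_left_comm]

/-- An edge used in both directions would be traversed twice. -/
theorem not_mem_bwdEdges {a b : V} (p : GPath Γ a b) (hp : p.edges.Nodup) {f : E}
    (hf : f ∈ p.fwdEdges) : f ∉ p.bwdEdges := by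
  induction p with
  | nil a => simp [bwdEdges]
  | fwd f' p ih =>
    simp only [edges, List.nodup_cons] at hp
    simp only [fwdEdges, List.mem_cons] at hf
    rcases hf with rfl | hf
    · exact fun h => hp.1 ((p.mem_edges_iff f).2 (Or.inr h))
    · exact ih hp.2 hf
  | bwd f' p ih =>
    simp only [edges, List.nodup_cons] at hp
    simp only [bwdEdges, List.mem_cons, not_or]
    refine ⟨?_, ih hp.2 hf⟩
    rintro rfl
    exact hp.1 ((p.mem_edges_iff f).2 (Or.inl hf))

/-- Along a path, matrices that represent the group elements of the edges multiply to the matrix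
of the holonomy. -/
theorem pathMatrix_mul_one {G : Type*} [Group G] [Fintype J] (N : G → Matrix J J ℂ)
    (hN : ∀ x y, N (x * y) = N x * N y) (x : E → G) (m : E → J × J → ℂ) {a b : V}
    (p : GPath Γ a b) (hf : ∀ f ∈ p.fwdEdges, ∀ s t, m f (s, t) = N (x f) t s)
    (hb : ∀ f ∈ p.bwdEdges, ∀ s t, m f (s, t) = N (x f)⁻¹ s t) :
    p.pathMatrix m * N 1 = N (p.word x) := by
  -- `N 1` need not be the identity: for `blockMat` it is the projection onto a block. The factor `N
  -- 1` corrects the identity matrix contributed by the empty path.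
  induction p with
  | nil a => simp [pathMatrix, word]
  | fwd f p ih =>
    simp only [fwdEdges, bwdEdges, List.mem_cons] at hf hb
    have h1 : (Matrix.of fun t s => m f (s, t)) = N (x f) := by
      ext t s
      exact hf f (Or.inl rfl) s t
    rw [pathMatrix, word, hN, ← ih (fun f' h' => hf f' (Or.inr h')) hb, h1, Matrix.mul_assoc,
      Matrix.mul_assoc, ← hN, ← hN, one_mul, mul_one]
  | bwd f p ih =>
    simp only [fwdEdges, bwdEdges, List.mem_cons] at hf hb
    have h1 : (Matrix.of fun s t => m f (s, t)) = N (x f)⁻¹ := by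
      ext s t
      exact hb f (Or.inl rfl) s t
    rw [pathMatrix, word, hN, ← ih hf (fun f' h' => hb f' (Or.inr h')), h1, Matrix.mul_assoc,
      Matrix.mul_assoc, ← hN, ← hN, one_mul, mul_one]

end GPath

/-! ### Matrices of several representations as blocks of matrices with a common index set -/

section Blocks

variable {G : Type*} [TopologicalSpace G] [Group G] {O : Type*} [Fintype O] [DecidableEq O]
  (τ : O → UnitaryIrrep G)

/-- The disjoint union of the sets of indices of the matrices of a family of representations. -/
abbrev BlockIndex : Type _ := Σ o, Fin (finrank ℂ (τ o).space)

/-- The inclusion of the indices of one block. -/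
def blockInclusion (o : O) : Matrix (BlockIndex τ) (Fin (finrank ℂ (τ o).space)) ℂ :=
  Matrix.of fun j a => if j = ⟨o, a⟩ then 1 else 0

/-- The matrix of a representation, extended by zero to the common index set. -/
def blockMat (o : O) (x : G) : Matrix (BlockIndex τ) (BlockIndex τ) ℂ :=
  blockInclusion τ o * (τ o).mat x * (blockInclusion τ o).transpose

theorem blockInclusion_transpose_mul (o : O) :
    (blockInclusion τ o).transpose * blockInclusion τ o = 1 := by
  ext a b
  simp [blockInclusion, Matrix.mul_apply, Matrix.one_apply, eq_comm]

/-- The columns of `blockInclusion` are orthonormal, so extension by zero preserves products,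
although the unit of G goes to a projection. -/
theorem blockMat_mul (o : O) (x y : G) :
    blockMat τ o (x * y) = blockMat τ o x * blockMat τ o y := by
  have : blockMat τ o x * blockMat τ o y = blockInclusion τ o * (τ o).mat x *
      ((blockInclusion τ o).transpose * blockInclusion τ o) * (τ o).mat y *
      (blockInclusion τ o).transpose := by
    simp only [blockMat, Matrix.mul_assoc]
  rw [this, blockInclusion_transpose_mul, Matrix.mul_one, blockMat, map_mul]
  simp only [Matrix.mul_assoc]

theorem blockMat_eq_sum (o : O) (x : G) (i j : BlockIndex τ) :
    blockMat τ o x i j = ∑ a, ∑ b, blockInclusion τ o i a * blockInclusion τ o j b *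
      (τ o).mat x a b := by
  simp only [blockMat, Matrix.mul_apply, Matrix.transpose_apply, Finset.sum_mul]
  rw [Finset.sum_comm]
  exact Finset.sum_congr rfl fun a _ => Finset.sum_congr rfl fun b _ => by ring

theorem blockMat_apply (o : O) (x : G) (l k) :
    blockMat τ o x ⟨o, l⟩ ⟨o, k⟩ = (τ o).mat x l k := by
  simp [blockMat_eq_sum, blockInclusion]

/-- Columns inside the block are fixed by its projection; this removes the factor `N 1` of
`GPath.pathMatrix_mul_one`. -/
theorem mul_blockMat_one_apply (o : O) (M : Matrix (BlockIndex τ) (BlockIndex τ) ℂ) (l k) :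
    (M * blockMat τ o 1) l ⟨o, k⟩ = M l ⟨o, k⟩ := by
  rw [blockMat, map_one, Matrix.mul_one]
  simp [Matrix.mul_apply, blockInclusion]

theorem continuous_blockMat (o : O) (i j) : Continuous fun x => blockMat τ o x i j := by
  simp only [blockMat_eq_sum]
  exact continuous_finsetSum _ fun a _ => continuous_finsetSum _ fun b _ =>
    continuous_const.mul ((τ o).continuous_mat a b)

theorem UnitaryIrrep.mat_trivial (x : G) : (UnitaryIrrep.trivial G).mat x = 1 := by
  change LinearMap.toMatrix _ _ (LinearMap.id : ℂ →ₗ[ℂ] ℂ) = 1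
  exact LinearMap.toMatrix_id _

/-- The block is a single entry 1. It supplies a weight of total mass 1 for the edges that lie on no
path. -/
theorem sum_blockMat_of_trivial {o : O} (ho : τ o = UnitaryIrrep.trivial G) (x : G) :
    ∑ i, ∑ j, blockMat τ o x i j = 1 := by
  have h0 : ∀ a, ∑ i, blockInclusion τ o i a = 1 := fun a => by simp [blockInclusion]
  have h1 : ∑ i, ∑ j, blockMat τ o x i j = ∑ a, ∑ b, (τ o).mat x a b := by
    have h2 : ∀ z : Fin (finrank ℂ (τ o).space) × Fin (finrank ℂ (τ o).space),
        ∑ i, ∑ j, blockInclusion τ o i z.1 * blockInclusion τ o j z.2 * (τ o).mat x z.1 z.2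
          = (τ o).mat x z.1 z.2 := by
      intro z
      simp only [← Finset.sum_mul, ← Finset.mul_sum, h0, mul_one, one_mul]
    simp only [blockMat_eq_sum]
    rw [← Fintype.sum_prod_type' (f := fun a b => (τ o).mat x a b), Finset.sum_congr rfl
      fun z _ => (h2 z).symm, ← Fintype.sum_prod_type']
    simp only [← Fintype.sum_prod_type']
    exact Fintype.sum_equiv (Equiv.prodComm _ _) _ _ fun _ => rfl
  rw [h1, ho, UnitaryIrrep.mat_trivial]
  have : finrank ℂ (UnitaryIrrep.trivial G).space = 1 := finrank_self ℂ
  simp [Matrix.one_apply, this]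

variable [IsTopologicalGroup G] [CompactSpace G]
  [MeasurableSpace G] [BorelSpace G] (μ : Measure G) [IsProbabilityMeasure μ]
  [μ.IsMulLeftInvariant]

/-- Extension by zero acts on row and column indices separately, so it preserves the product form of
the integrals. -/
theorem exists_integral_mat_mul_star_blockMat (π : UnitaryIrrep G) (o : O) :
    ∃ u w : Fin (finrank ℂ π.space) → BlockIndex τ → ℂ, ∀ l k t s,
      ∫ x, π.mat x l k * star (blockMat τ o x t s) ∂μ = u l t * w k s := by
  obtain ⟨u, w, h⟩ := UnitaryIrrep.exists_integral_mat_mul_star μ π (τ o)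
  refine ⟨fun l t => ∑ a, star (blockInclusion τ o t a) * u l a,
    fun k s => ∑ b, star (blockInclusion τ o s b) * w k b, fun l k t s => ?_⟩
  have hint : ∀ a b, Integrable (fun x => star (blockInclusion τ o t a) *
      star (blockInclusion τ o s b) * (π.mat x l k * star ((τ o).mat x a b))) μ := fun a b =>
    UnitaryIrrep.integrable_of_continuous μ (continuous_const.mul
      ((π.continuous_mat l k).mul ((τ o).continuous_mat a b).star))
  have h1 : ∀ x, π.mat x l k * star (blockMat τ o x t s)
      = ∑ a, ∑ b, star (blockInclusion τ o t a) *
      star (blockInclusion τ o s b) * (π.mat x l k * star ((τ o).mat x a b)) := by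
    intro x
    simp only [blockMat_eq_sum, star_sum, star_mul', Finset.mul_sum]
    exact Finset.sum_congr rfl fun a _ => Finset.sum_congr rfl fun b _ => by ring
  simp only [h1]
  rw [integral_finsetSum _ fun a _ => integrable_finsetSum _ fun b _ => hint a b]
  simp only [integral_finsetSum _ fun b _ => hint _ b, integral_const_mul, h, Finset.sum_mul,
    Finset.mul_sum]
  rw [Finset.sum_comm]
  exact Finset.sum_congr rfl fun a _ => Finset.sum_congr rfl fun b _ => by ring

theorem exists_integral_mat_mul_star_blockMat_inv (π : UnitaryIrrep G) (o : O) :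
    ∃ u w : Fin (finrank ℂ π.space) → BlockIndex τ → ℂ, ∀ l k t s,
      ∫ x, π.mat x l k * star (blockMat τ o x⁻¹ s t) ∂μ = u l t * w k s := by
  obtain ⟨u, w, h⟩ := UnitaryIrrep.exists_integral_mat_mul_star_inv μ π (τ o)
  refine ⟨fun l t => ∑ a, star (blockInclusion τ o t a) * u l a,
    fun k s => ∑ b, star (blockInclusion τ o s b) * w k b, fun l k t s => ?_⟩
  have hint : ∀ a b, Integrable (fun x => star (blockInclusion τ o t a) *
      star (blockInclusion τ o s b) * (π.mat x l k * star ((τ o).mat x⁻¹ b a))) μ := fun a b =>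
    UnitaryIrrep.integrable_of_continuous μ (continuous_const.mul
      ((π.continuous_mat l k).mul (((τ o).continuous_mat b a).comp continuous_inv).star))
  have h1 : ∀ x, π.mat x l k * star (blockMat τ o x⁻¹ s t)
      = ∑ a, ∑ b, star (blockInclusion τ o t a) *
      star (blockInclusion τ o s b) * (π.mat x l k * star ((τ o).mat x⁻¹ b a)) := by
    intro x
    simp only [blockMat_eq_sum, star_sum, star_mul', Finset.mul_sum]
    rw [Finset.sum_comm]
    exact Finset.sum_congr rfl fun a _ => Finset.sum_congr rfl fun b _ => by ring
  simp only [h1]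
  rw [integral_finsetSum _ fun a _ => integrable_finsetSum _ fun b _ => hint a b]
  simp only [integral_finsetSum _ fun b _ => hint _ b, integral_const_mul, h, Finset.sum_mul,
    Finset.mul_sum]
  rw [Finset.sum_comm]
  exact Finset.sum_congr rfl fun a _ => Finset.sum_congr rfl fun b _ => by ring

end Blocks

/-! ### Factorization of the coefficients over the vertices. -/

section Coefficients

variable {G : Type*} [TopologicalSpace G] [Group G] [IsTopologicalGroup G] [CompactSpace G]
  [MeasurableSpace G] [BorelSpace G] (μ : Measure G) [IsProbabilityMeasure μ]
  [μ.IsMulLeftInvariant]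
  {V E E' : Type*} [Fintype V] [Fintype E] [Fintype E'] {Γ : DirGraph V E}

/-- The function on `G^E` obtained by contracting tensors `C v` at the vertices with the matrices
of the representations of the edges. -/
def contraction (Γ : DirGraph V E) (ρ : E → UnitaryIrrep G)
    (C : ∀ v, (∀ e : Outgoing Γ v, BasisIndex ρ e) → (∀ e : Incoming Γ v, BasisIndex ρ e) → ℂ)
    (x : E → G) : ℂ :=
  open scoped Classical in
  ∑ K : ∀ e, BasisIndex ρ e, ∑ L : ∀ e, BasisIndex ρ e,
    (∏ v, C v (fun e => K e) fun e => L e) * ∏ e, (ρ e).mat (x e) (L e) (K e)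

/-- For disjoint paths in a graph, the weights of the edges that expand the products of the
matrices of `σ e` along the paths. -/
theorem exists_edge_weight {O : Type*} [Fintype O] [DecidableEq O] (τ : O → UnitaryIrrep G)
    (o₀ : O) (ho₀ : τ o₀ = UnitaryIrrep.trivial G) (π : UnitaryIrrep G) (F B : E' → Prop)
    (o : E' → O)
    (hF : ∀ e e', (F e ∨ B e) → (F e' ∨ B e') → e = e') (hFB : ∀ e, F e → ¬ B e) :
    ∃ n : G → BlockIndex τ × BlockIndex τ → ℂ,
      (∀ z, Continuous fun x => n x z) ∧
      (∀ e, F e → ∀ x s t, n x (s, t) = blockMat τ (o e) x t s) ∧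
      (∀ e, B e → ∀ x s t, n x (s, t) = blockMat τ (o e) x⁻¹ s t) ∧
      ((∀ e, ¬ (F e ∨ B e)) → ∀ x, ∑ z, n x z = 1) ∧
      ∃ u w : Fin (finrank ℂ π.space) → BlockIndex τ → ℂ, ∀ l k s t,
        ∫ x, π.mat x l k * star (n x (s, t)) ∂μ = u l t * w k s := by
  -- An edge is used by at most one path, in one direction: forwards it carries the matrix at x,
  -- backwards the matrix at x⁻¹. An edge on no path carries the trivial block.
  by_cases h : ∃ e, F e ∨ B e
  · obtain ⟨e, he | he⟩ := h
    · refine ⟨fun x z => blockMat τ (o e) x z.2 z.1, fun z => continuous_blockMat τ _ _ _,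
        ?_, ?_, ?_, ?_⟩
      · intro e' he' x s t
        rw [hF e e' (Or.inl he) (Or.inl he')]
      · intro e' he'
        rw [← hF e e' (Or.inl he) (Or.inr he')] at he'
        exact absurd he' (hFB e he)
      · intro h
        exact absurd (Or.inl he) (h e)
      · obtain ⟨u, w, h⟩ := exists_integral_mat_mul_star_blockMat τ μ π (o e)
        exact ⟨u, w, fun l k s t => h l k t s⟩
    · refine ⟨fun x z => blockMat τ (o e) x⁻¹ z.1 z.2,
        fun z => (continuous_blockMat τ _ _ _).comp continuous_inv, ?_, ?_, ?_, ?_⟩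
      · intro e' he'
        rw [← hF e e' (Or.inr he) (Or.inl he')] at he'
        exact absurd he (hFB e he')
      · intro e' he' x s t
        rw [hF e e' (Or.inr he) (Or.inr he')]
      · intro h
        exact absurd (Or.inr he) (h e)
      · obtain ⟨u, w, h⟩ := exists_integral_mat_mul_star_blockMat_inv τ μ π (o e)
        exact ⟨u, w, fun l k s t => h l k t s⟩
  · push Not at h
    refine ⟨fun x z => blockMat τ o₀ x z.2 z.1, fun z => continuous_blockMat τ _ _ _,
      fun e he => absurd he (h e).1, fun e he => absurd he (h e).2, fun _ x => ?_, ?_⟩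
    · rw [Fintype.sum_prod_type_right]
      exact sum_blockMat_of_trivial τ ho₀ x
    · obtain ⟨u, w, h⟩ := exists_integral_mat_mul_star_blockMat τ μ π o₀
      exact ⟨u, w, fun l k s t => h l k t s⟩

open scoped Classical in
theorem prod_fibres {V E : Type*} [Fintype V] [Fintype E] (s : E → V) (g : E → ℂ) :
    ∏ f, g f = ∏ v, ∏ f : {f // s f = v}, g f :=
  (Fintype.prod_fiberwise s g).symm

variable [SecondCountableTopology G]

/-- The coefficients of a contraction with respect to the matrix coefficients of the holonomies
along disjoint paths are products over the vertices of functions that depend only on the indices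
at the vertex. -/
theorem exists_integral_contraction_eq_prod (ρ : E → UnitaryIrrep G)
    (C : ∀ v, (∀ e : Outgoing Γ v, BasisIndex ρ e) → (∀ e : Incoming Γ v, BasisIndex ρ e) → ℂ)
    (σ : E' → UnitaryIrrep G) {a b : E' → V} (p : ∀ e, GPath Γ (a e) (b e))
    (hp : ∀ e, (p e).edges.Nodup)
    (hd : ∀ f e e', f ∈ (p e).edges → f ∈ (p e').edges → e = e') :
    ∃ Q : V → (∀ e, BasisIndex σ e) → (∀ e, BasisIndex σ e) → ℂ,
      (∀ v k l k' l', (∀ e, a e = v → k e = k' e) → (∀ e, b e = v → l e = l' e) →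
        Q v k l = Q v k' l') ∧
      ∀ k l, ∫ x, contraction Γ ρ C x * ∏ e, star ((σ e).mat ((p e).word x) (l e) (k e))
        ∂(Measure.pi fun _ : E => μ) = ∏ v, Q v k l := by
  classical
  -- One block index for all the σ e gives the ends of all edges indices of the same type, whichever
  -- path they lie on; `none` is the trivial representation, for edges on no path.
  let τ : Option E' → UnitaryIrrep G := fun o => o.elim (UnitaryIrrep.trivial G) σ
  let J := BlockIndex τ
  have key := fun f : E => exists_edge_weight μ τ none rfl (ρ f) (fun e => f ∈ (p e).fwdEdges)
    (fun e => f ∈ (p e).bwdEdges) some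
    (fun e e' h h' => hd f e e' (((p e).mem_edges_iff f).2 h) (((p e').mem_edges_iff f).2 h'))
    (fun e h => (p e).not_mem_bwdEdges (hp e) h)
  choose n hnc hnF hnB hn1 u w huw using key
  have hJ : Nonempty J := ⟨⟨none, ⟨0, (τ none).finrank_pos⟩⟩⟩
  let ix : ∀ e, BasisIndex σ e → J := fun e k => ⟨some e, k⟩
  have hstar : ∀ (k l : ∀ e, BasisIndex σ e) (x : E → G), ∏ e, star ((σ e).mat ((p e).word x) (l e) (k e))
      = ∑ Z : E → J × J, (∏ f, star (n f (x f) (Z f))) *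
        ∏ e, (p e).fullLink Z (ix e (k e)) (ix e (l e)) := by
    intro k l x
    have h1 : ∀ e, (σ e).mat ((p e).word x) (l e) (k e)
        = (p e).pathMatrix (fun f => n f (x f)) (ix e (l e)) (ix e (k e)) := by
      intro e
      have h2 := (p e).pathMatrix_mul_one (blockMat τ (some e)) (blockMat_mul τ (some e)) x
        (fun f => n f (x f)) (fun f hf s t => hnF f e hf _ s t) (fun f hf s t => hnB f e hf _ s t)
      have h3 := congrFun (congrFun h2 ⟨some e, l e⟩) ⟨some e, k e⟩
      exact (blockMat_apply τ (some e) _ (l e) (k e)).symm.trans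
        (h3.symm.trans (mul_blockMat_one_apply τ (some e) _ _ (k e)))
    simp only [h1]
    rw [← star_prod, ← GPath.weightedSum_prod_fullLink p hp hd (fun e => ix e (k e))
      (fun e => ix e (l e)) Finset.univ (fun f => n f (x f)) fun f hf => hn1 f (fun e he =>
        hf e (Finset.mem_univ e) (((p e).mem_edges_iff f).2 he)) (x f)]
    simp only [weightedSum, star_sum, star_mul', star_prod, GPath.star_fullLink]
  let j₀ : J := Classical.arbitrary J
  -- Every edge end at v carries an index of ρ and an index of the path expansion. Schur's lemma
  -- leaves `w` at the source of an edge and `u` at its target. `link` at v reads only indices at v,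
  -- so `j₀` is mere filler elsewhere.
  let Q : V → (∀ e, BasisIndex σ e) → (∀ e, BasisIndex σ e) → ℂ := fun v k l =>
    ∑ κ : ∀ e : Outgoing Γ v, BasisIndex ρ e × J, ∑ lam : ∀ e : Incoming Γ v, BasisIndex ρ e × J,
      C v (fun e => (κ e).1) (fun e => (lam e).1) *
      (∏ e, (p e).link (fun f => if h : Γ.source f = v then (κ ⟨f, h⟩).2 else j₀)
        (fun f => if h : Γ.target f = v then (lam ⟨f, h⟩).2 else j₀) (ix e (k e)) (ix e (l e)) v) *
      ((∏ e : Outgoing Γ v, w e (κ e).1 (κ e).2) * ∏ e : Incoming Γ v, u e (lam e).1 (lam e).2)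
  refine ⟨Q, ?_, ?_⟩
  · intro v k l k' l' hk hl
    refine Finset.sum_congr rfl fun κ _ => Finset.sum_congr rfl fun lam _ => ?_
    congr 2
    refine Finset.prod_congr rfl fun e _ => GPath.link_congr _ (fun _ _ => rfl) (fun _ _ => rfl)
      (fun h => ?_) fun h => ?_
    · rw [hk e h.symm]
    · rw [hl e h.symm]
  · intro k l
    let D : (∀ e, BasisIndex ρ e) → (∀ e, BasisIndex ρ e) → (E → J × J) → ℂ := fun K L Z =>
      (∏ v, C v (fun e => K e) fun e => L e) *
        ∏ e, (p e).fullLink Z (ix e (k e)) (ix e (l e))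
    have hint : ∀ K L Z, Integrable (fun x : E → G => D K L Z *
        ∏ f, ((ρ f).mat (x f) (L f) (K f) * star (n f (x f) (Z f)))) (Measure.pi fun _ => μ) := by
      intro K L Z
      refine UnitaryIrrep.integrable_of_continuous _ (continuous_const.mul
        (continuous_finsetProd _ fun f _ => ?_))
      exact (((ρ f).continuous_mat _ _).comp (continuous_apply f)).mul
        ((hnc f _).comp (continuous_apply f)).star
    have hfun : ∀ x : E → G, contraction Γ ρ C x *
        ∏ e, star ((σ e).mat ((p e).word x) (l e) (k e)) = ∑ K, ∑ L, ∑ Z, D K L Z *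
          ∏ f, ((ρ f).mat (x f) (L f) (K f) * star (n f (x f) (Z f))) := by
      intro x
      rw [hstar, contraction]
      simp only [Finset.sum_mul]
      refine Finset.sum_congr rfl fun K _ => Finset.sum_congr rfl fun L _ => ?_
      rw [Finset.mul_sum]
      refine Finset.sum_congr rfl fun Z _ => ?_
      rw [Finset.prod_mul_distrib]
      ring
    simp only [hfun]
    rw [integral_finsetSum _ fun K _ => integrable_finsetSum _ fun L _ =>
      integrable_finsetSum _ fun Z _ => hint K L Z]
    simp only [integral_finsetSum _ fun L _ => integrable_finsetSum _ fun Z _ => hint _ L Z,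
      integral_finsetSum _ fun Z _ => hint _ _ Z, integral_const_mul]
    have hprod : ∀ (K L : ∀ e, BasisIndex ρ e) (Z : E → J × J),
        ∫ x : E → G, ∏ f, ((ρ f).mat (x f) (L f) (K f) * star (n f (x f) (Z f)))
          ∂(Measure.pi fun _ => μ) = ∏ f, (u f (L f) (Z f).2 * w f (K f) (Z f).1) := by
      intro K L Z
      rw [integral_fintype_prod_eq_prod
        (fun f y => (ρ f).mat y (L f) (K f) * star (n f y (Z f)))]
      exact Finset.prod_congr rfl fun f _ => huw f _ _ _ _
    simp only [hprod]
    have hQ : ∏ v, Q v k l = _ := prod_sum_fibres Γ.source Γ.target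
      (X := fun e => BasisIndex ρ e × J) (Y := fun e => BasisIndex ρ e × J)
      fun v κ lam => C v (fun e => (κ e).1) (fun e => (lam e).1) *
      (∏ e, (p e).link (fun f => if h : Γ.source f = v then (κ ⟨f, h⟩).2 else j₀)
        (fun f => if h : Γ.target f = v then (lam ⟨f, h⟩).2 else j₀) (ix e (k e)) (ix e (l e)) v) *
      ((∏ e : Outgoing Γ v, w e (κ e).1 (κ e).2) * ∏ e : Incoming Γ v, u e (lam e).1 (lam e).2)
    rw [hQ]
    simp only [← Fintype.sum_prod_type']
    -- Indices grouped by kind (K, L, Z) are regrouped by edge end: source indices together, target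
    -- indices together.
    refine Fintype.sum_equiv
      { toFun := fun z => (fun e => (z.1 e, (z.2.2 e).1), fun e => (z.2.1 e, (z.2.2 e).2))
        invFun := fun z => (fun e => (z.1 e).1, fun e => (z.2 e).1,
          fun e => ((z.1 e).2, (z.2 e).2))
        left_inv := fun _ => rfl
        right_inv := fun _ => rfl } _ _ ?_
    rintro ⟨K, L, Z⟩
    simp only [Equiv.coe_fn_mk, Finset.prod_mul_distrib, D]
    rw [prod_fibres Γ.source (fun f => w f (K f) (Z f).1),
      prod_fibres Γ.target (fun f => u f (L f) (Z f).2), Finset.prod_comm]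
    have hl : ∀ e, ∏ v, (p e).link
        (fun f => if h : Γ.source f = v then (Z f).1 else j₀)
        (fun f => if h : Γ.target f = v then (Z f).2 else j₀) (ix e (k e)) (ix e (l e)) v
        = (p e).fullLink Z (ix e (k e)) (ix e (l e)) := by
      intro e
      rw [show Z = fun f => ((Z f).1, (Z f).2) from rfl, ← GPath.prod_link]
      refine Finset.prod_congr rfl fun v _ => GPath.link_congr _ ?_ ?_ (fun _ => rfl) fun _ => rfl
      · intro f hf
        simp [hf]
      · intro f hf
        simp [hf]
    rw [Finset.prod_congr rfl fun e _ => hl e]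
    ring

end Coefficients

/-! ### Averaging the vertex tensors over the gauge group. -/

section Invariants

variable {G : Type*} [TopologicalSpace G] [Group G] [IsTopologicalGroup G] [CompactSpace G]
  [MeasurableSpace G] [BorelSpace G] (μ : Measure G) [IsProbabilityMeasure μ]
  [μ.IsMulLeftInvariant]

/-- The average over a compact group of a vector in a finite-dimensional representation. -/
theorem exists_invariant_average {W ι : Type*} [AddCommGroup W] [Module ℂ W] [Fintype ι]
    (R : Representation ℂ G W) (b : Basis ι ℂ W)
    (hR : ∀ w i, Continuous fun g => b.repr (R g w) i) (w : W) :
    ∃ w' ∈ R.invariants, ∀ i, b.repr w' i = ∫ g, b.repr (R g w) i ∂μ := by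
  classical
  refine ⟨b.equivFun.symm fun i => ∫ g, b.repr (R g w) i ∂μ, fun h => ?_, fun i => ?_⟩
  · apply b.equivFun.injective
    rw [LinearEquiv.apply_symm_apply]
    funext i
    have hexp : ∀ z, b.repr (R h z) i = ∑ j, b.repr z j * b.repr (R h (b j)) i := by
      intro z
      have hz := congrArg (fun u => b.repr (R h u) i) (b.sum_repr z).symm
      simpa only [map_sum, map_smul, Finsupp.coe_finsetSum, Finset.sum_apply, Finsupp.smul_apply,
        smul_eq_mul] using hz
    rw [Basis.equivFun_apply, hexp]
    have h1 : ∀ j, b.repr (b.equivFun.symm fun i => ∫ g, b.repr (R g w) i ∂μ) j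
        = ∫ g, b.repr (R g w) j ∂μ := by
      intro j
      rw [← Basis.equivFun_apply, LinearEquiv.apply_symm_apply]
    simp only [h1, ← integral_mul_const]
    rw [← integral_finsetSum _ fun j _ =>
      (UnitaryIrrep.integrable_of_continuous μ (hR w j)).mul_const _,
      ← integral_mul_left_eq_self (fun g => b.repr (R g w) i) h]
    congr 1
    funext g
    rw [map_mul, Module.End.mul_apply, hexp]
  · rw [← Basis.equivFun_apply, LinearEquiv.apply_symm_apply]

variable {V E : Type*} [Fintype E] (Γ : DirGraph V E) (ρ : E → UnitaryIrrep G)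

theorem edgeBasis_coord_rep (e : E) (g : G) (k l : BasisIndex ρ e) :
    (edgeBasis ρ e).coord l ((ρ e).rep g (edgeBasis ρ e k)) = (ρ e).mat g l k :=
  ((ρ e).matrixIn_apply _ g l k).symm

open scoped Classical in
-- The dual representation acts by the transposed inverse, whence g⁻¹ and the exchanged indices at
-- incoming edges.
theorem vertexBasis_repr_vertexRep_basis (v : V) (g : G) (K K' : ∀ e : Outgoing Γ v, BasisIndex ρ e)
    (L L' : ∀ e : Incoming Γ v, BasisIndex ρ e) :
    (vertexBasis Γ ρ v).repr (vertexRep Γ ρ v g (vertexBasis Γ ρ v (K', L'))) (K, L)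
      = (∏ e : Outgoing Γ v, (ρ e).mat g (K e) (K' e)) *
        ∏ e : Incoming Γ v, (ρ e).mat g⁻¹ (L' e) (L e) := by
  rw [vertexBasis, Basis.tensorProduct_apply, Basis.piTensorProduct_apply,
    Basis.piTensorProduct_apply]
  have h1 : vertexRep Γ ρ v g ((⨂ₜ[ℂ] e : Outgoing Γ v, edgeBasis ρ e (K' e)) ⊗ₜ[ℂ]
      (⨂ₜ[ℂ] e : Incoming Γ v, (edgeBasis ρ e).dualBasis (L' e)))
      = (⨂ₜ[ℂ] e : Outgoing Γ v, (ρ e).rep g (edgeBasis ρ e (K' e))) ⊗ₜ[ℂ]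
      (⨂ₜ[ℂ] e : Incoming Γ v, (ρ e).rep.dual g ((edgeBasis ρ e).dualBasis (L' e))) := by
    simp only [vertexRep, Representation.tprod_apply, TensorProduct.map_tmul]
    congr 1
    · exact PiTensorProduct.map_tprod _ _
    · exact PiTensorProduct.map_tprod _ _
  rw [h1, Basis.tensorProduct_repr_tmul_apply, Basis.piTensorProduct_repr_tprod_apply,
    Basis.piTensorProduct_repr_tprod_apply]
  rw [smul_eq_mul, mul_comm]
  congr 1
  · exact Finset.prod_congr rfl fun e _ => edgeBasis_coord_rep ρ e g (K' e) (K e)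
  · refine Finset.prod_congr rfl fun e _ => ?_
    rw [← edgeBasis_coord_rep, Basis.dualBasis_repr]
    simp only [Representation.dual_apply, Basis.coe_dualBasis]
    rfl

open scoped Classical in
theorem vertexBasis_repr_vertexRep (v : V) (g : G) (w : VertexSpace Γ ρ v)
    (K : ∀ e : Outgoing Γ v, BasisIndex ρ e) (L : ∀ e : Incoming Γ v, BasisIndex ρ e) :
    (vertexBasis Γ ρ v).repr (vertexRep Γ ρ v g w) (K, L)
      = ∑ K', ∑ L', (vertexBasis Γ ρ v).repr w (K', L') *
        ((∏ e : Outgoing Γ v, (ρ e).mat g (K e) (K' e)) *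
        ∏ e : Incoming Γ v, (ρ e).mat g⁻¹ (L' e) (L e)) := by
  conv_lhs => rw [← (vertexBasis Γ ρ v).sum_repr w]
  simp only [map_sum, map_smul, Finsupp.coe_finsetSum, Finset.sum_apply, Finsupp.smul_apply,
    smul_eq_mul, Fintype.sum_prod_type, vertexBasis_repr_vertexRep_basis]

theorem continuous_vertexBasis_repr_vertexRep (v : V) (w : VertexSpace Γ ρ v) (i) :
    Continuous fun g => (vertexBasis Γ ρ v).repr (vertexRep Γ ρ v g w) i := by
  classical
  obtain ⟨K, L⟩ := i
  simp only [vertexBasis_repr_vertexRep]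
  refine continuous_finsetSum _ fun K' _ => continuous_finsetSum _ fun L' _ =>
    continuous_const.mul (Continuous.mul
      (continuous_finsetProd _ fun (e : Outgoing Γ v) _ => (ρ e).continuous_mat _ _)
      (continuous_finsetProd _ fun (e : Incoming Γ v) _ =>
        ((ρ e).continuous_mat _ _).comp continuous_inv))

/-- The tensor at a vertex with given coordinates. -/
def tensorOfCoords (v : V)
    (C : (∀ e : Outgoing Γ v, BasisIndex ρ e) → (∀ e : Incoming Γ v, BasisIndex ρ e) → ℂ) :
    VertexSpace Γ ρ v :=
  (vertexBasis Γ ρ v).repr.symm (Finsupp.equivFunOnFinite.symm fun i => C i.1 i.2)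

theorem repr_tensorOfCoords (v : V)
    (C : (∀ e : Outgoing Γ v, BasisIndex ρ e) → (∀ e : Incoming Γ v, BasisIndex ρ e) → ℂ) (K L) :
    (vertexBasis Γ ρ v).repr (tensorOfCoords Γ ρ v C) (K, L) = C K L := by
  simp [tensorOfCoords]

variable [Fintype V]

theorem spinNetworkAmplitude_eq (ι : ∀ v, VertexSpace Γ ρ v) (x : E → G) :
    spinNetworkAmplitude Γ ρ ι x = (∏ e, (Real.sqrt (finrank ℂ (ρ e).space) : ℂ)) *
      contraction Γ ρ (fun v K L => (vertexBasis Γ ρ v).repr (ι v) (K, L)) x := by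
  simp only [spinNetworkAmplitude, contraction, edgeBasis_coord_rep]

theorem continuous_contraction
    (C : ∀ v, (∀ e : Outgoing Γ v, BasisIndex ρ e) → (∀ e : Incoming Γ v, BasisIndex ρ e) → ℂ) :
    Continuous (contraction Γ ρ C) := by
  unfold contraction
  exact continuous_finsetSum _ fun K _ => continuous_finsetSum _ fun L _ =>
    continuous_const.mul (continuous_finsetProd _ fun e _ =>
      ((ρ e).continuous_mat _ _).comp (continuous_apply e))

open scoped Classical in
/-- Gauge transformations act on a contraction through the tensors at the vertices. -/
theorem contraction_gauge (κ : ∀ v, VertexSpace Γ ρ v) (g : V → G) (x : E → G) :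
    contraction Γ ρ (fun v K L => (vertexBasis Γ ρ v).repr (κ v) (K, L))
        (fun e => (g (Γ.target e))⁻¹ * x e * g (Γ.source e))
      = contraction Γ ρ
        (fun v K L => (vertexBasis Γ ρ v).repr (vertexRep Γ ρ v (g v) (κ v)) (K, L)) x := by
  -- Both sides are expanded to the same fourfold sum: here the action on the tensors, below the
  -- matrix products on the edges.
  have h1 : ∀ (K L : ∀ e, BasisIndex ρ e),
      ∏ v, (vertexBasis Γ ρ v).repr (vertexRep Γ ρ v (g v) (κ v)) (fun e => K e, fun e => L e)
      = ∑ K' : ∀ e, BasisIndex ρ e, ∑ L' : ∀ e, BasisIndex ρ e,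
        (∏ v, (vertexBasis Γ ρ v).repr (κ v) (fun e => K' e, fun e => L' e)) *
          ∏ e, ((ρ e).mat (g (Γ.source e)) (K e) (K' e) *
            (ρ e).mat (g (Γ.target e))⁻¹ (L' e) (L e)) := by
    intro K L
    simp only [vertexBasis_repr_vertexRep]
    rw [prod_sum_fibres Γ.source Γ.target (X := BasisIndex ρ) (Y := BasisIndex ρ)
      fun v K' L' => (vertexBasis Γ ρ v).repr (κ v) (K', L') *
        ((∏ e : Outgoing Γ v, (ρ e).mat (g v) (K e) (K' e)) *
        ∏ e : Incoming Γ v, (ρ e).mat (g v)⁻¹ (L' e) (L e))]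
    refine Finset.sum_congr rfl fun K' _ => Finset.sum_congr rfl fun L' _ => ?_
    rw [Finset.prod_mul_distrib, Finset.prod_mul_distrib, Finset.prod_mul_distrib,
      prod_fibres Γ.source (fun e => (ρ e).mat (g (Γ.source e)) (K e) (K' e)),
      prod_fibres Γ.target (fun e => (ρ e).mat (g (Γ.target e))⁻¹ (L' e) (L e))]
    congr 2
    · refine Finset.prod_congr rfl fun v _ => Finset.prod_congr rfl ?_
      rintro ⟨e, rfl⟩ _
      rfl
    · refine Finset.prod_congr rfl fun v _ => Finset.prod_congr rfl ?_
      rintro ⟨e, rfl⟩ _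
      rfl
  have h2 : ∀ (K' L' : ∀ e, BasisIndex ρ e),
      ∏ e, (ρ e).mat ((g (Γ.target e))⁻¹ * x e * g (Γ.source e)) (L' e) (K' e)
      = ∑ K : ∀ e, BasisIndex ρ e, ∑ L : ∀ e, BasisIndex ρ e,
        (∏ e, ((ρ e).mat (g (Γ.source e)) (K e) (K' e) *
            (ρ e).mat (g (Γ.target e))⁻¹ (L' e) (L e))) *
          ∏ e, (ρ e).mat (x e) (L e) (K e) := by
    intro K' L'
    have h3 : ∀ e, (ρ e).mat ((g (Γ.target e))⁻¹ * x e * g (Γ.source e)) (L' e) (K' e)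
        = ∑ k, ∑ l, (ρ e).mat (g (Γ.source e)) k (K' e) *
          (ρ e).mat (g (Γ.target e))⁻¹ (L' e) l * (ρ e).mat (x e) l k := by
      intro e
      simp only [map_mul, Matrix.mul_apply, Finset.sum_mul]
      exact Finset.sum_congr rfl fun k _ => Finset.sum_congr rfl fun l _ => by ring
    simp only [h3, Finset.prod_univ_sum, Fintype.piFinset_univ, ← Finset.prod_mul_distrib]
  simp only [contraction, h1, h2, Finset.sum_mul, Finset.mul_sum]
  simp only [← Fintype.sum_prod_type']
  refine Fintype.sum_equiv
    { toFun := fun z => (z.2.2.1, z.2.2.2, z.1, z.2.1)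
      invFun := fun z => (z.2.2.1, z.2.2.2, z.1, z.2.1)
      left_inv := fun _ => rfl
      right_inv := fun _ => rfl } _ _ fun z => ?_
  simp only [Equiv.coe_fn_mk]
  ring

variable [SecondCountableTopology G]

/-- A gauge invariant contraction can be written with invariant tensors at the vertices. -/
theorem exists_invariant_tensors (μ : Measure G) [IsProbabilityMeasure μ]
    [μ.IsMulLeftInvariant]
    (C : ∀ v, (∀ e : Outgoing Γ v, BasisIndex ρ e) → (∀ e : Incoming Γ v, BasisIndex ρ e) → ℂ)
    (hC : ∀ (g : V → G) (x : E → G),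
      contraction Γ ρ C (fun e => (g (Γ.target e))⁻¹ * x e * g (Γ.source e))
        = contraction Γ ρ C x) :
    ∃ ι : ∀ v, Inv Γ ρ v, ∀ x, contraction Γ ρ C x
      = contraction Γ ρ (fun v K L => (vertexBasis Γ ρ v).repr (ι v : VertexSpace Γ ρ v) (K, L))
        x := by
  classical
  let κ : ∀ v, VertexSpace Γ ρ v := fun v => tensorOfCoords Γ ρ v (C v)
  have hκ : C = fun v K L => (vertexBasis Γ ρ v).repr (κ v) (K, L) := by
    funext v K L
    exact (repr_tensorOfCoords Γ ρ v (C v) K L).symm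
  choose ι hι hιr using fun v => exists_invariant_average μ (vertexRep Γ ρ v) (vertexBasis Γ ρ v)
    (fun w i => continuous_vertexBasis_repr_vertexRep Γ ρ v w i) (κ v)
  refine ⟨fun v => ⟨ι v, hι v⟩, fun x => ?_⟩
  -- A constant function of g equals its average; the integrand is a sum of products over the
  -- vertices, so the average passes to each tensor separately.
  have h1 : contraction Γ ρ C x = ∫ g : V → G, contraction Γ ρ
      (fun v K L => (vertexBasis Γ ρ v).repr (vertexRep Γ ρ v (g v) (κ v)) (K, L)) x
        ∂(Measure.pi fun _ => μ) := by
    have : ∀ g : V → G, contraction Γ ρ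
        (fun v K L => (vertexBasis Γ ρ v).repr (vertexRep Γ ρ v (g v) (κ v)) (K, L)) x
          = contraction Γ ρ C x := by
      intro g
      rw [← contraction_gauge, ← hκ, hC]
    simp only [this, integral_const, probReal_univ, one_smul]
  rw [h1]
  simp only [contraction]
  have hint : ∀ K L : ∀ e, BasisIndex ρ e, Integrable (fun g : V → G =>
      (∏ v, (vertexBasis Γ ρ v).repr (vertexRep Γ ρ v (g v) (κ v)) (fun e => K e, fun e => L e)) *
        ∏ e, (ρ e).mat (x e) (L e) (K e)) (Measure.pi fun _ => μ) := fun K L =>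
    UnitaryIrrep.integrable_of_continuous _ ((continuous_finsetProd _ fun v _ =>
      (continuous_vertexBasis_repr_vertexRep Γ ρ v _ _).comp (continuous_apply v)).mul
        continuous_const)
  rw [integral_finsetSum _ fun K _ => integrable_finsetSum _ fun L _ => hint K L]
  simp only [integral_finsetSum _ fun L _ => hint _ L, integral_mul_const]
  refine Finset.sum_congr rfl fun K _ => Finset.sum_congr rfl fun L _ => ?_
  congr 1
  rw [integral_fintype_prod_eq_prod fun v h =>
    (vertexBasis Γ ρ v).repr (vertexRep Γ ρ v h (κ v)) (fun e => K e, fun e => L e)]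
  exact Finset.prod_congr rfl fun v _ => (hιr v _).symm

end Invariants

/-! ### Translations along the first edges of disjoint paths -/

section Translations

variable {V E E' G : Type*} [Group G] {Γ : DirGraph V E}

/-- Translation by `g` of the holonomy of an edge, in the direction given by the sign. -/
def edgeTranslate (s : Bool) (g x : G) : G := if s then x * g else g⁻¹ * x

/-- The first edge contributes the last factor of the word and does not recur. The edge and the side
of the translation are chosen before g, since g later becomes the variable. -/
theorem GPath.exists_word_update [DecidableEq E] {a b : V} (p : GPath Γ a b) (h1 : p.edges ≠ [])
    (h2 : p.edges.Nodup) : ∃ f ∈ p.edges, ∃ s : Bool, ∀ (g : G) (x : E → G),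
      p.word (Function.update x f (edgeTranslate s g (x f))) = p.word x * g := by
  cases p with
  | nil => exact absurd rfl h1
  | fwd f p =>
    simp only [GPath.edges, List.nodup_cons] at h2
    refine ⟨f, by simp [GPath.edges], true, fun g x => ?_⟩
    rw [GPath.word, p.word_congr (y := x) fun f' hf' => Function.update_of_ne
      (by rintro rfl; exact h2.1 hf') _ _]
    simp [GPath.word, edgeTranslate, mul_assoc]
  | bwd f p =>
    simp only [GPath.edges, List.nodup_cons] at h2
    refine ⟨f, by simp [GPath.edges], false, fun g x => ?_⟩
    rw [GPath.word, p.word_congr (y := x) fun f' hf' => Function.update_of_ne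
      (by rintro rfl; exact h2.1 hf') _ _]
    simp [GPath.word, edgeTranslate, mul_assoc]

open scoped Classical in
/-- Simultaneous translation of the holonomies of the edges `f e`. -/
def translate (f : E' → E) (s : E' → Bool) (g : E' → G) (x : E → G) (j : E) : G :=
  if h : ∃ e, f e = j then edgeTranslate (s h.choose) (g h.choose) (x j) else x j

theorem translate_apply {f : E' → E} (hf : Function.Injective f) (s : E' → Bool) (g : E' → G)
    (x : E → G) (e : E') :
    translate f s g x (f e) = edgeTranslate (s e) (g e) (x (f e)) := by
  have h : ∃ e', f e' = f e := ⟨e, rfl⟩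
  have he : h.choose = e := hf h.choose_spec
  rw [translate, dif_pos h, he]

theorem translate_of_not_mem (f : E' → E) (s : E' → Bool) (g : E' → G)
    (x : E → G) {j : E} (hj : j ∉ Set.range f) : translate f s g x j = x j :=
  dif_neg hj

end Translations

/-! ### Vertices outside the image. -/

theorem prod_eq_prod_mul_prod_compl_range {A B : Type*} [Fintype A] [Fintype B] {j : A → B}
    (hj : Function.Injective j) (g : B → ℂ) :
    open scoped Classical in
    ∏ b, g b = (∏ a, g (j a)) * ∏ b : {b // b ∉ Set.range j}, g b := by
  classical
  rw [← Fintype.prod_subtype_mul_prod_subtype (fun b => b ∈ Set.range j) g]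
  congr 1
  convert (Fintype.prod_equiv (Equiv.ofInjective j hj) (fun a => g (j a))
    (fun b : {b // b ∈ Set.range j} => g b) fun a => rfl).symm

/-- A function on `V'` with local factors at the vertices of `V` restricts to one with local
factors at the vertices of a graph mapped injectively to `V`; constants are absorbed. -/
theorem exists_local_factors {G : Type*} [TopologicalSpace G] [Group G] {V V' E' : Type*}
    [Fintype V] [Fintype V'] [Nonempty V'] [Fintype E'] (ψ : DirGraph V' E') {j : V' → V}
    (hj : Function.Injective j) (σ : E' → UnitaryIrrep G) (z : ℂ)
    (Q : V → (∀ e, BasisIndex σ e) → (∀ e, BasisIndex σ e) → ℂ)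
    (hQ : ∀ v k l k' l', (∀ e, j (ψ.source e) = v → k e = k' e) →
      (∀ e, j (ψ.target e) = v → l e = l' e) → Q v k l = Q v k' l') :
    ∃ C : ∀ v, (∀ e : Outgoing ψ v, BasisIndex σ e) → (∀ e : Incoming ψ v, BasisIndex σ e) → ℂ,
      ∀ k l, z * ∏ v, Q v k l = ∏ v, C v (fun e => k e) fun e => l e := by
  classical
  let k₀ : ∀ e, BasisIndex σ e := fun e => ⟨0, (σ e).finrank_pos⟩
  let v₀ : V' := Classical.arbitrary V'
  -- No edge of ψ ends outside the range of j, so those factors are constants and may be evaluated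
  -- at `k₀`. They and z are put on the single vertex `v₀`.
  let W : ℂ := z * ∏ b : {b // b ∉ Set.range j}, Q b k₀ k₀
  refine ⟨fun v κ lam => (if v = v₀ then W else 1) * Q (j v)
    (fun e => if h : ψ.source e = v then κ ⟨e, h⟩ else k₀ e)
    (fun e => if h : ψ.target e = v then lam ⟨e, h⟩ else k₀ e), fun k l => ?_⟩
  rw [Finset.prod_mul_distrib, Finset.prod_ite_eq' Finset.univ v₀ fun _ => W,
    if_pos (Finset.mem_univ _), prod_eq_prod_mul_prod_compl_range hj]
  have h1 : ∀ b : {b // b ∉ Set.range j}, Q b k l = Q b k₀ k₀ := fun b =>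
    hQ _ _ _ _ _ (fun e he => absurd ⟨_, he⟩ b.2) fun e he => absurd ⟨_, he⟩ b.2
  have h2 : ∀ v, Q (j v) (fun e => if h : ψ.source e = v then k e else k₀ e)
      (fun e => if h : ψ.target e = v then l e else k₀ e) = Q (j v) k l := by
    intro v
    refine hQ _ _ _ _ _ (fun e he => ?_) fun e he => ?_
    · simp [hj he]
    · simp [hj he]
  simp only [h1, h2, W]
  ring

/-! ### Expansion in products of matrix coefficients. -/

section Reproducing

variable {G : Type*} [TopologicalSpace G] [Group G] [IsTopologicalGroup G] [CompactSpace G]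
  [MeasurableSpace G] [BorelSpace G] [SecondCountableTopology G] (μ : Measure G)
  [IsProbabilityMeasure μ] [μ.IsMulLeftInvariant] {E' : Type*} [Fintype E']

/-- A linear combination of products of matrix coefficients is determined by its integrals against
products of matrix coefficients. -/
theorem sum_integral_mul_prod_mat (σ : E' → UnitaryIrrep G) {ι : Type*} (s : Finset ι) (c : ι → ℂ)
    (g : ι → E' → G → ℂ) (hg : ∀ i e, (σ e).IsCoeff (g i e)) (f : (E' → G) → ℂ)
    (hf : ∀ y, f y = ∑ i ∈ s, c i * ∏ e, g i e (y e)) (y : E' → G) :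
    open scoped Classical in
    ∑ k : ∀ e, BasisIndex σ e, ∑ l : ∀ e, BasisIndex σ e,
      ((∏ e, (finrank ℂ (σ e).space : ℂ)) *
        ∫ x, f x * ∏ e, star ((σ e).mat (x e) (l e) (k e)) ∂(Measure.pi fun _ => μ)) *
        ∏ e, (σ e).mat (y e) (l e) (k e) = f y := by
  classical
  have hint : ∀ i (k l : ∀ e, BasisIndex σ e), Integrable (fun x : E' → G =>
      c i * ∏ e, (g i e (x e) * star ((σ e).mat (x e) (l e) (k e)))) (Measure.pi fun _ => μ) :=
    fun i k l => UnitaryIrrep.integrable_of_continuous _ (continuous_const.mul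
      (continuous_finsetProd _ fun e _ => ((hg i e).continuous.comp (continuous_apply e)).mul
        (((σ e).continuous_mat _ _).comp (continuous_apply e)).star))
  have h1 : ∀ k l : ∀ e, BasisIndex σ e,
      ∫ x, f x * ∏ e, star ((σ e).mat (x e) (l e) (k e)) ∂(Measure.pi fun _ => μ)
        = ∑ i ∈ s, c i * ∏ e, ∫ x, g i e x * star ((σ e).mat x (l e) (k e)) ∂μ := by
    intro k l
    have h2 : ∀ x : E' → G, f x * ∏ e, star ((σ e).mat (x e) (l e) (k e))
        = ∑ i ∈ s, c i * ∏ e, (g i e (x e) * star ((σ e).mat (x e) (l e) (k e))) := by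
      intro x
      simp only [hf, Finset.sum_mul, Finset.prod_mul_distrib, mul_assoc]
    simp only [h2]
    rw [integral_finsetSum _ fun i _ => hint i k l]
    refine Finset.sum_congr rfl fun i _ => ?_
    rw [integral_const_mul, integral_fintype_prod_eq_prod
      fun e x => g i e x * star ((σ e).mat x (l e) (k e))]
  -- Each one-variable factor is reproduced by `IsCoeff.eq_sum`, and the product of sums is
  -- multiplied out.
  have h3 : ∀ i, ∏ e, g i e (y e) = ∑ k : ∀ e, BasisIndex σ e, ∑ l : ∀ e, BasisIndex σ e,
      ((∏ e, (finrank ℂ (σ e).space : ℂ)) *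
        ∏ e, ∫ x, g i e x * star ((σ e).mat x (l e) (k e)) ∂μ) *
        ∏ e, (σ e).mat (y e) (l e) (k e) := by
    intro i
    rw [Finset.prod_congr rfl fun e _ => ((hg i e).eq_sum μ (y e)).symm]
    simp only [Finset.prod_univ_sum, Fintype.piFinset_univ, Finset.prod_mul_distrib]
  simp only [h1]
  simp only [hf, h3, Finset.mul_sum, Finset.sum_mul]
  simp only [← Fintype.sum_prod_type']
  rw [Finset.sum_comm]
  refine Finset.sum_congr rfl fun i _ => Finset.sum_congr rfl fun z _ => ?_
  ring

end Reproducing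

/-! ### Descent from φ to ψ in coordinates. -/

section Descent

variable {G : Type*} [TopologicalSpace G] [Group G] [IsTopologicalGroup G] [CompactSpace G]
  [MeasurableSpace G] [BorelSpace G] [SecondCountableTopology G] (μ : Measure G)
  [IsProbabilityMeasure μ] [μ.IsMulLeftInvariant] [μ.IsMulRightInvariant]

theorem measurePreserving_edgeTranslate (s : Bool) (g : G) :
    MeasurePreserving (edgeTranslate s g) μ μ := by
  cases s
  · exact MeasureTheory.measurePreserving_mul_left μ g⁻¹
  · exact MeasureTheory.measurePreserving_mul_right μ g

theorem measurePreserving_translate {E E' : Type*} [Fintype E] (f : E' → E) (s : E' → Bool)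
    (g : E' → G) : MeasurePreserving (translate f s g) (Measure.pi fun _ : E => μ)
      (Measure.pi fun _ : E => μ) := by
  classical
  refine measurePreserving_pi (fun _ => μ) (fun _ => μ) (f := fun j y =>
    if h : ∃ e, f e = j then edgeTranslate (s h.choose) (g h.choose) y else y) fun j => ?_
  by_cases h : ∃ e, f e = j
  · simp only [h, dif_pos]
    exact measurePreserving_edgeTranslate μ _ _
  · simp only [h, dif_neg, not_false_eq_true]
    exact MeasurePreserving.id μ

theorem continuous_edgeTranslate (s : Bool) :
    Continuous fun z : G × G => edgeTranslate s z.1 z.2 := by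
  cases s
  · exact continuous_fst.inv.mul continuous_snd
  · exact continuous_snd.mul continuous_fst

theorem continuous_translate {E E' : Type*} (f : E' → E) (s : E' → Bool) :
    Continuous fun z : (E' → G) × (E → G) => translate f s z.1 z.2 := by
  classical
  refine continuous_pi fun j => ?_
  by_cases h : ∃ e, f e = j
  · simp only [translate, h, dif_pos]
    exact (continuous_edgeTranslate (s h.choose)).comp
      (((continuous_apply h.choose : Continuous fun g : E' → G => g h.choose).comp
        continuous_fst).prodMk
      ((continuous_apply j : Continuous fun x : E → G => x j).comp continuous_snd))
  · simp only [translate, h, dif_neg, not_false_eq_true]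
    exact (continuous_apply j : Continuous fun x : E → G => x j).comp continuous_snd

/-- Translated matrix coefficients of an irreducible representation are matrix coefficients of a
representation in a transversal. -/
theorem exists_isCoeff_edgeTranslate {Λ : Set (UnitaryIrrep G)} (hΛ : IsIrrepTransversal Λ)
    (π : UnitaryIrrep G) (s : Bool) (a b : G) :
    ∃ σ ∈ Λ, ∀ l k, σ.IsCoeff fun y => π.mat (edgeTranslate s (a * y) b) l k := by
  -- A left translation by (a y)⁻¹ involves y⁻¹ and calls for the conjugate of π; a right
  -- translation keeps π.
  cases s
  · obtain ⟨σ, ⟨hσ, hequiv⟩, -⟩ := hΛ.1 π.conj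
    refine ⟨σ, hσ, fun l k => .of_equivalent hequiv ?_⟩
    simpa [edgeTranslate, mul_assoc] using π.isCoeff_conj_mat_inv_mul (a⁻¹ * b) l k
  · obtain ⟨σ, ⟨hσ, hequiv⟩, -⟩ := hΛ.1 π
    refine ⟨σ, hσ, fun l k => .of_equivalent hequiv ?_⟩
    simpa [edgeTranslate, mul_assoc] using π.isCoeff_mat_mul (b * a) l k

variable {V E V' E' : Type*} [Fintype V] [Fintype E] [Fintype V'] [Fintype E']
  {ψ : DirGraph V' E'} {φ : DirGraph V E}

theorem continuous_word {a b : V} (p : GPath φ a b) : Continuous fun x : E → G => p.word x := by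
  induction p with
  | nil a => exact continuous_const
  | fwd f p ih => exact ih.mul (continuous_apply f)
  | bwd f p ih => exact ih.mul (continuous_apply f).inv

theorem continuous_spinNetworkAmplitude (ρ : E → UnitaryIrrep G) (ι : ∀ v, VertexSpace φ ρ v) :
    Continuous (spinNetworkAmplitude φ ρ ι) := by
  have : spinNetworkAmplitude φ ρ ι = fun x =>
    (∏ e, (Real.sqrt (finrank ℂ (ρ e).space) : ℂ)) *
      contraction φ ρ (fun v K L => (vertexBasis φ ρ v).repr (ι v) (K, L)) x :=
    funext fun x => spinNetworkAmplitude_eq φ ρ ι x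
  rw [this]
  exact continuous_const.mul (continuous_contraction φ ρ _)

/-- If the composition of `F` with the holonomies along the paths of an inclusion is a spin network
amplitude, then `F` agrees almost everywhere with a continuous function that is a linear
combination of products of matrix coefficients. -/
theorem exists_sum_coefficients {Λ : Set (UnitaryIrrep G)} (hΛ : IsIrrepTransversal Λ)
    (i : Inclusion ψ φ) (ρ : E → UnitaryIrrep G) (ι : ∀ v, VertexSpace φ ρ v)
    (F : (E' → G) → ℂ) (hFm : Measurable F)
    (hF : ∀ᵐ x ∂(Measure.pi fun _ : E => μ),
      F (fun e => (i.path e).word x) = spinNetworkAmplitude φ ρ ι x) :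
    ∃ σ : E' → UnitaryIrrep G, (∀ e, σ e ∈ Λ) ∧ ∃ F' : (E' → G) → ℂ, Continuous F' ∧
      F =ᵐ[Measure.pi fun _ : E' => μ] F' ∧
      ∀ y, open scoped Classical in
      ∑ k : ∀ e, BasisIndex σ e, ∑ l : ∀ e, BasisIndex σ e,
      ((∏ e, (finrank ℂ (σ e).space : ℂ)) *
        ∫ x, F' x * ∏ e, star ((σ e).mat (x e) (l e) (k e)) ∂(Measure.pi fun _ => μ)) *
        ∏ e, (σ e).mat (y e) (l e) (k e) = F' y := by
  classical
  choose f hf s hs using fun e => (i.path e).exists_word_update (G := G) (i.path_simple e).1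
    (i.path_simple e).2.1
  have hfinj : Function.Injective f := fun e e' h =>
    i.path_disjoint (f e) e e' (hf e) (h ▸ hf e')
  have hword : ∀ (g : E' → G) x e,
      (i.path e).word (translate f s g x) = (i.path e).word x * g e := by
    intro g x e
    rw [← hs]
    refine GPath.word_congr _ fun j hj => ?_
    by_cases hje : j = f e
    · subst hje
      rw [Function.update_self, translate_apply hfinj]
    · rw [Function.update_of_ne hje, translate_of_not_mem]
      rintro ⟨e', rfl⟩
      rw [i.path_disjoint _ e' e (hf e') hj] at hje
      exact hje rfl
  have hΦ := continuous_spinNetworkAmplitude ρ ι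
  have hcw : Continuous fun (x : E → G) e => (i.path e).word x :=
    continuous_pi fun e => continuous_word (i.path e)
  have h1 : ∀ g : E' → G, ∀ᵐ x ∂(Measure.pi fun _ : E => μ),
      F ((fun e => (i.path e).word x) * g) = spinNetworkAmplitude φ ρ ι (translate f s g x) := by
    intro g
    filter_upwards [(measurePreserving_translate μ f s g).quasiMeasurePreserving.ae hF] with x hx
    rw [← hx]
    congr 1
    funext e
    exact (hword g x e).symm
  have hmeas : MeasurableSet {z : (E' → G) × (E → G) |
      F ((fun e => (i.path e).word z.2) * z.1)
        = spinNetworkAmplitude φ ρ ι (translate f s z.1 z.2)} := by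
    refine measurableSet_eq_fun (hFm.comp ?_) (hΦ.comp (continuous_translate f s)).measurable
    exact ((hcw.comp continuous_snd).mul continuous_fst).measurable
  -- Fubini: what holds for every g and almost every x holds, for almost every x, at almost every g.
  -- One such x is fixed.
  have h2 := (Measure.ae_ae_comm (μ := Measure.pi fun _ : E' => μ)
    (ν := Measure.pi fun _ : E => μ) hmeas).1 (Filter.Eventually.of_forall h1)
  obtain ⟨x₀, hx₀⟩ := h2.exists
  let w₀ : E' → G := fun e => (i.path e).word x₀
  -- At x₀ the relation expresses F(w₀ g) by Φ; here g = w₀⁻¹ y.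
  let F' : (E' → G) → ℂ := fun y => spinNetworkAmplitude φ ρ ι (translate f s (w₀⁻¹ * y) x₀)
  choose σ hσ hcoeff using fun e =>
    exists_isCoeff_edgeTranslate hΛ (ρ (f e)) (s e) (w₀ e)⁻¹ (x₀ (f e))
  refine ⟨σ, hσ, F', ?_, ?_, ?_⟩
  · exact hΦ.comp ((continuous_translate f s).comp
      ((continuous_const.mul continuous_id).prodMk continuous_const))
  · filter_upwards [(MeasureTheory.measurePreserving_mul_left (Measure.pi fun _ : E' => μ)
      w₀⁻¹).quasiMeasurePreserving.ae hx₀] with y hy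
    change F y = spinNetworkAmplitude φ ρ ι (translate f s (w₀⁻¹ * y) x₀)
    rw [← hy]
    change F y = F (w₀ * (w₀⁻¹ * y))
    rw [mul_inv_cancel_left]
  -- Only the edges f e depend on y. The matrix entries of the other edges at x₀ are constants and
  -- join the coefficients.
  · refine sum_integral_mul_prod_mat μ σ
      (Finset.univ : Finset ((∀ e, BasisIndex ρ e) × (∀ e, BasisIndex ρ e)))
      (fun z => (∏ e, (Real.sqrt (finrank ℂ (ρ e).space) : ℂ)) *
        ((∏ v, (vertexBasis φ ρ v).repr (ι v) (fun e => z.1 e, fun e => z.2 e)) *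
          ∏ j : {j // j ∉ Set.range f}, (ρ j).mat (x₀ j) (z.2 j) (z.1 j)))
      (fun z e y => (ρ (f e)).mat (edgeTranslate (s e) ((w₀ e)⁻¹ * y) (x₀ (f e)))
        (z.2 (f e)) (z.1 (f e))) (fun z e => hcoeff e _ _) F' fun y => ?_
    change spinNetworkAmplitude φ ρ ι (translate f s (w₀⁻¹ * y) x₀) = _
    rw [spinNetworkAmplitude_eq, contraction, ← Fintype.sum_prod_type', Finset.mul_sum]
    refine Finset.sum_congr rfl fun z _ => ?_
    rw [prod_eq_prod_mul_prod_compl_range hfinj fun e =>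
      (ρ e).mat (translate f s (w₀⁻¹ * y) x₀ e) (z.2 e) (z.1 e)]
    have h3 : ∀ j : {j // j ∉ Set.range f}, translate f s (w₀⁻¹ * y) x₀ j = x₀ j := fun j =>
      translate_of_not_mem f s _ _ j.2
    simp only [h3, translate_apply hfinj, Pi.mul_apply, Pi.inv_apply]
    ring

/-- If the composition of a gauge invariant function `F` with the holonomies along the paths of an
inclusion is a spin network amplitude, then so is `F`. -/
theorem exists_spinNetworkAmplitude [μ.IsOpenPosMeasure] [Nonempty V']
    {Λ : Set (UnitaryIrrep G)}
    (hΛ : IsIrrepTransversal Λ) (i : Inclusion ψ φ) (ρ : E → UnitaryIrrep G)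
    (ι : ∀ v, VertexSpace φ ρ v) (F : (E' → G) → ℂ) (hFm : Measurable F)
    (hw : MeasurePreserving (fun (x : E → G) e => (i.path e).word x)
      (Measure.pi fun _ => μ) (Measure.pi fun _ => μ))
    (hF : ∀ᵐ x ∂(Measure.pi fun _ : E => μ),
      F (fun e => (i.path e).word x) = spinNetworkAmplitude φ ρ ι x)
    (hinv : ∀ (g : V' → G) y,
      F (fun e => (g (ψ.target e))⁻¹ * y e * g (ψ.source e)) = F y) :
    ∃ σ : E' → UnitaryIrrep G, (∀ e, σ e ∈ Λ) ∧ ∃ ι' : ∀ v, Inv ψ σ v,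
      F =ᵐ[Measure.pi fun _ : E' => μ] spinNetworkAmplitude ψ σ fun v => ι' v := by
  classical
  obtain ⟨σ, hσ, F', hF'c, hFF', hrep⟩ := exists_sum_coefficients μ hΛ i ρ ι F hFm hF
  refine ⟨σ, hσ, ?_⟩
  obtain ⟨Q, hQ, hQint⟩ := exists_integral_contraction_eq_prod μ ρ
    (fun v K L => (vertexBasis φ ρ v).repr (ι v) (K, L)) σ i.path
    (fun e => (i.path_simple e).2.1) i.path_disjoint
  let N : ℂ := ∏ e, (Real.sqrt (finrank ℂ (σ e).space) : ℂ)
  have hN : N ≠ 0 := Finset.prod_ne_zero_iff.2 fun e _ => by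
    have h := (σ e).finrank_pos
    have h' : Real.sqrt (finrank ℂ (σ e).space) ≠ 0 := by positivity
    exact_mod_cast h'
  -- The dimensions come from the reproducing formula and the square roots for ρ from the amplitude
  -- on φ; N⁻¹ makes room for the normalization of the amplitude on ψ.
  let z : ℂ := N⁻¹ * ((∏ e, (finrank ℂ (σ e).space : ℂ)) *
    ∏ e, (Real.sqrt (finrank ℂ (ρ e).space) : ℂ))
  obtain ⟨C, hC⟩ := exists_local_factors ψ i.vertex_injective σ z Q hQ
  have hint : ∀ k l : ∀ e, BasisIndex σ e,
      ∫ y, F' y * ∏ e, star ((σ e).mat (y e) (l e) (k e)) ∂(Measure.pi fun _ => μ)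
        = (∏ e, (Real.sqrt (finrank ℂ (ρ e).space) : ℂ)) * ∏ v, Q v k l := by
    intro k l
    have hcont : Continuous fun y : E' → G =>
        F' y * ∏ e, star ((σ e).mat (y e) (l e) (k e)) :=
      hF'c.mul (continuous_finsetProd _ fun e _ =>
        (((σ e).continuous_mat _ _).comp (continuous_apply e)).star)
    -- The integral over G^{E'} is pulled back along the holonomies, where F' may be replaced by the
    -- given amplitude.
    rw [← hw.map_eq, integral_map hw.measurable.aemeasurable
      hcont.measurable.aestronglyMeasurable, ← hQint, ← integral_const_mul]
    refine integral_congr_ae ?_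
    filter_upwards [hw.quasiMeasurePreserving.ae hFF', hF] with x hx hx'
    rw [← hx, hx', spinNetworkAmplitude_eq, mul_assoc]
  have hF'C : ∀ y, F' y = N * contraction ψ σ C y := by
    intro y
    rw [← hrep y, contraction, Finset.mul_sum]
    refine Finset.sum_congr rfl fun k _ => ?_
    rw [Finset.mul_sum]
    refine Finset.sum_congr rfl fun l _ => ?_
    rw [← hC, hint]
    simp only [z]
    field_simp
  have hF'inv : ∀ (g : V' → G) (y : E' → G),
      F' (fun e => (g (ψ.target e))⁻¹ * y e * g (ψ.source e)) = F' y := by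
    intro g y
    have hmp : MeasurePreserving
        (fun (y : E' → G) e => (g (ψ.target e))⁻¹ * y e * g (ψ.source e))
        (Measure.pi fun _ => μ) (Measure.pi fun _ => μ) :=
      measurePreserving_pi (fun _ => μ) (fun _ => μ) fun e =>
        (MeasureTheory.measurePreserving_mul_right μ (g (ψ.source e))).comp
          (MeasureTheory.measurePreserving_mul_left μ (g (ψ.target e))⁻¹)
    have hc : Continuous fun (y : E' → G) e => (g (ψ.target e))⁻¹ * y e * g (ψ.source e) :=
      continuous_pi fun e => (continuous_const.mul (continuous_apply e)).mul continuous_const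
    have hae : (fun y : E' → G => F' fun e => (g (ψ.target e))⁻¹ * y e * g (ψ.source e))
        =ᵐ[Measure.pi fun _ => μ] F' := by
      filter_upwards [hmp.quasiMeasurePreserving.ae hFF', hFF'] with y hy hy'
      rw [← hy, hinv, hy']
    -- Both functions are continuous and the measure charges open sets, so invariance almost
    -- everywhere is invariance everywhere.
    exact congrFun (((hF'c.comp hc).ae_eq_iff_eq _ hF'c).1 hae) y
  obtain ⟨ι', hι'⟩ := exists_invariant_tensors ψ σ μ C fun g y => by
    have := hF'inv g y
    rw [hF'C, hF'C] at this
    exact mul_left_cancel₀ hN this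
  refine ⟨ι', hFF'.trans (Filter.Eventually.of_forall fun y => ?_)⟩
  rw [hF'C, hι', spinNetworkAmplitude_eq]

end Descent

end SpinNetwork

end

/-! ### The lemma for bundles, by passage to coordinates. -/

theorem mainTheorem5
    {𝔼 : Type*} [NormedAddCommGroup 𝔼] [NormedSpace ℝ 𝔼] [FiniteDimensional ℝ 𝔼]
    {G : Type*} [TopologicalSpace G] [ChartedSpace 𝔼 G] [Group G]
    [LieGroup 𝓘(ℝ, 𝔼) ∞ G] [CompactSpace G] [T2Space G] [MeasurableSpace G] [BorelSpace G]
    (Λ : Set (SpinNetwork.UnitaryIrrep G)) (hΛ : SpinNetwork.IsIrrepTransversal Λ)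
    {Vψ Eψ Vφ Eφ : Type*} [Fintype Vψ] [Fintype Eψ] [Fintype Vφ] [Fintype Eφ] [Nonempty Vψ]
    (ψ : SpinNetwork.DirGraph Vψ Eψ) (φ : SpinNetwork.DirGraph Vφ Eφ)
    (i : SpinNetwork.Inclusion ψ φ) (P : SpinNetwork.PrincipalBundle 𝔼 G Vφ)
    (Ψ : SpinNetwork.L2 (P.pullback i.vertex) ψ)
    (hΨ : SpinNetwork.IsSpinNetworkState Λ (i.isometry P Ψ)) :
    SpinNetwork.IsSpinNetworkState Λ Ψ := by
  classical
  have : IsTopologicalGroup G := topologicalGroup_of_lieGroup 𝓘(ℝ, 𝔼) ∞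
  have : SecondCountableTopology G := ChartedSpace.secondCountable_of_sigmaCompact 𝔼 G
  have := SpinNetwork.normalizedHaar_isHaarMeasure (𝔼 := 𝔼) (G := G)
  set μ : Measure G := SpinNetwork.normalizedHaar 𝔼 G with hμ
  have : μ.IsMulRightInvariant :=
    ⟨fun g => (SpinNetwork.measurePreserving_mul_right (𝔼 := 𝔼) g).map_eq⟩
  obtain ⟨ρ, -, ι, hι⟩ := hΨ
  let cψ : (Eψ → G) → SpinNetwork.Connection (P.pullback i.vertex) ψ := fun y e =>
    (SpinNetwork.Transport.coordEquiv (P.pullback i.vertex) _ _).symm (y e)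
  let cφ : (Eφ → G) → SpinNetwork.Connection P φ := fun x e =>
    (SpinNetwork.Transport.coordEquiv P _ _).symm (x e)
  have hcψ : MeasurePreserving cψ (Measure.pi fun _ => μ)
      (SpinNetwork.connectionMeasure (P.pullback i.vertex) ψ) :=
    SpinNetwork.measurePreserving_ofCoords (P.pullback i.vertex) ψ
  have hcφ : MeasurePreserving cφ (Measure.pi fun _ => μ) (SpinNetwork.connectionMeasure P φ) :=
    SpinNetwork.measurePreserving_ofCoords P φ
  have hcoordψ : ∀ y e, (cψ y e).coord = y e := fun y e =>
    SpinNetwork.Transport.coord_coordEquiv_symm _ _ _ _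
  have hcoordφ : ∀ x e, (cφ x e).coord = x e := fun x e =>
    SpinNetwork.Transport.coord_coordEquiv_symm _ _ _ _
  have hpull : ∀ x, i.pullConnection P (cφ x) = cψ fun e => (i.path e).word x := by
    intro x
    funext e
    apply SpinNetwork.Transport.coord_injective
    refine (i.coord_pullConnection P (cφ x) e).trans (Eq.trans ?_
      (hcoordψ (fun e => (i.path e).word x) e).symm)
    simp only [hcoordφ]
  let F : (Eψ → G) → ℂ := fun y => Ψ (SpinNetwork.toModuli (cψ y))
  have hFm : Measurable F := (Lp.stronglyMeasurable Ψ).measurable.comp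
    (SpinNetwork.measurable_toModuli.comp hcψ.measurable)
  have hmod : ∀ᵐ m ∂SpinNetwork.moduliMeasure P φ, i.isometry P Ψ m = Ψ (i.pullModuli P m) :=
    Lp.coeFn_compMeasurePreserving Ψ (i.measurePreserving_pullModuli P)
  have hF : ∀ᵐ x ∂(Measure.pi fun _ : Eφ => μ), F (fun e => (i.path e).word x)
      = SpinNetwork.spinNetworkAmplitude φ ρ (fun v => ι v) x := by
    have h1 := ae_of_ae_map SpinNetwork.measurable_toModuli.aemeasurable hmod
    filter_upwards [hcφ.quasiMeasurePreserving.ae h1, hcφ.quasiMeasurePreserving.ae hι]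
      with x hx hx'
    rw [hx, i.pullModuli_toModuli, hpull] at hx'
    simp only [hcoordφ] at hx'
    exact hx'
  -- The invariance is pointwise because F evaluates a fixed representative of Ψ on gauge orbits.
  -- The gauge transformation is g⁻¹, to match the sign convention of `contraction_gauge`.
  have hinv : ∀ (g : Vψ → G) y,
      F (fun e => (g (ψ.target e))⁻¹ * y e * g (ψ.source e)) = F y := by
    intro g y
    refine congrArg Ψ (Quotient.sound ?_)
    refine ⟨fun v => SpinNetwork.Transport.ofCoord (P.pullback i.vertex) v v (g v)⁻¹, ?_⟩
    funext e
    apply SpinNetwork.Transport.coord_injective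
    change (SpinNetwork.Transport.coord ((_ • cψ y) e)) = _
    rw [SpinNetwork.smul_apply]
    simp only [SpinNetwork.Transport.coord_comp, SpinNetwork.Transport.coord_inv,
      SpinNetwork.Transport.coord_ofCoord, hcoordψ, inv_inv]
  obtain ⟨σ, hσ, ι', hι'⟩ := SpinNetwork.exists_spinNetworkAmplitude μ hΛ i ρ (fun v => ι v) F hFm
    (SpinNetwork.measurePreserving_words (𝔼 := 𝔼) i) hF hinv
  refine ⟨σ, hσ, ι', ?_⟩
  -- Taking coordinates is inverse to `cψ` and preserves the measures, so the equality on G^{Eψ}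
  -- returns to connections.
  have hd : MeasurePreserving (fun (A : SpinNetwork.Connection (P.pullback i.vertex) ψ) e =>
      (A e).coord) (SpinNetwork.connectionMeasure (P.pullback i.vertex) ψ)
      (Measure.pi fun _ => μ) := by
    have hm : Measurable fun (A : SpinNetwork.Connection (P.pullback i.vertex) ψ) e =>
        (A e).coord :=
      measurable_pi_lambda _ fun e => SpinNetwork.measurable_coord.comp (measurable_pi_apply e)
    refine ⟨hm, ?_⟩
    rw [← hcψ.map_eq, Measure.map_map hm hcψ.measurable]
    have : (fun (A : SpinNetwork.Connection (P.pullback i.vertex) ψ) e => (A e).coord) ∘ cψ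
        = id := by
      funext y e
      exact hcoordψ y e
    rw [this, Measure.map_id]
  filter_upwards [hd.quasiMeasurePreserving.ae hι'] with A hA
  rw [← hA]
  have : cψ (fun e => (A e).coord) = A := by
    funext e
    exact SpinNetwork.Transport.coord_injective (hcoordψ (fun e => (A e).coord) e)
  simp only [F, this]
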